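/- Let $\mathbb{K}$ be a field of characteristic zero and let $(V,\cdot,\delta_V)$ be a not necessarily unitary, counitary (with counit $\epsilon_V$), commutative and cocommutative bialgebra over $\mathbb{K}$. Let $uV=\mathbb{K}\oplus V$ be its unitary extension, with $\delta_{uV}(\lambda+v)=\lambda 1\otimes 1+\delta_V(v)$ and $\epsilon_{uV}(\lambda+v)=\lambda+\epsilon_V(v)$. A double bialgebra $(B,m,\Delta,\delta)$ is a bialgebra $(B,m,\Delta)$ with counit $\varepsilon_\Delta$, together with a second coproduct $\delta$ with counit $\epsilon_\delta$, such that $(B,m,\delta)$ is a bialgebra and $(B,m,\Delta)$ is a bialgebra in the category of right $(B,m,\delta)$-comodules, with the coaction $\delta$. It is a double bialgebra over $V$ if it is given a right coaction $\rho:B\to B\otimes uV$ of $uV$ such that the unit, the product, $\varepsilon_\Delta$ and $\Delta$ are comodule morphisms, $\rho(\ker\varepsilon_\Delta)\subseteq B\otimes V$, and $(\mathrm{Id}\otimes c)\circ(\rho\otimes\mathrm{Id})\circ\delta=(\delta\otimes\mathrm{Id})\circ\rho$, where $c$ is the flip. For $x\in\ker\varepsilon_\Delta$ let $\tilde\Delta(x)=\Delta(x)-x\otimes1-1\otimes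 x$, and let $\tilde\Delta^{(0)}=\mathrm{Id}$, $\tilde\Delta^{(n)}=(\tilde\Delta^{(n-1)}\otimes\mathrm{Id})\circ\tilde\Delta$; $B$ is connected if $\ker\varepsilon_\Delta=\bigcup_{n\ge0}\ker\tilde\Delta^{(n)}$. Let $\mathrm{QSh}(V)=(T(V),\sqcup,\Delta,\delta,\rho)$ be the quasishuffle double bialgebra over $V$. Here $T(V)$ is the space of words in $V$; $\sqcup$ is the quasishuffle product, with unit the empty word $1$ and $$xv\sqcup yw=x(v\sqcup yw)+y(xv\sqcup w)+(x\cdot y)(v\sqcup w)\qquad(x,y\in V,\ v,w\in T(V));$$ $\Delta$ is the deconcatenation, and its counit $\varepsilon_\Delta$ is $1$ on the empty word and $0$ on nonempty words; with Sweedler's notation $\delta_V(v)=v'\otimes v''$, $$\delta(v_1\ldots v_k)=\sum_{1\le i_1<\ldots<i_p<k}\Big(\prod_{1\le i\le i_1}^{\cdot}v_i'\Big)\ldots\Big(\prod_{i_p+1\le i\le k}^{\cdot}v_i'\Big)\otimes(v_1''\ldots v_{i_1}'')\sqcup\ldots\sqcup(v_{i_p+1}''\ldots v_k'')$$ (the sum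 being over all the ways of cutting the word into nonempty blocks of consecutive letters, and $\delta(1)=1\otimes1$); its counit $\epsilon_\delta$ is $1$ on the empty word, $\epsilon_V$ on words of length $1$ and $0$ on longer words; and $\rho(v_1\ldots v_k)=v_1'\ldots v_k'\otimes v_1''\cdot\ldots\cdot v_k''$. Let $(B,m,\Delta,\delta,\rho)$ be a connected double bialgebra over $V$. Then there is a unique morphism $\phi_1:B\to\mathrm{QSh}(V)$ of double bialgebras over $V$, that is to say a morphism for the products, for both coproducts (with units and counits) and for the coactions. Let $\mathrm{Char}(B)$ be the set of characters of $B$, i.e. of unitary algebra morphisms $B\to\mathbb{K}$, and let $M^\rho_{B\to\mathrm{QSh}(V)}$ be the set of morphisms of bialgebras over $V$ from $B$ to $\mathrm{QSh}(V)$, i.e. of maps that are both bialgebra morphisms from $(B,m,\Delta)$ to $(T(V),\sqcup,\Delta)$ and comodule morphisms for $\rho$. The maps $$\theta:\mathrm{Char}(B)\to M^\rho_{B\to\mathrm{QSh}(V)},\quad\lambda\mapsto\phi_1\leftsquigarrow\lambda=(\phi_1\otimes\lambda)\circ\delta,\qquad\theta':M^\rho_{B\to\mathrm{QSh}(V)}\to\mathrm{Char}(B),\quad\phi\mapsto\epsilon_\delta\circ\phi,$$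 are well defined, and they are bijections, inverse one from the other. -/

import Mathlib

open scoped TensorProduct

noncomputable section

/-- A not necessarily unitary, counitary bialgebra: an associative algebra and a coalgebra whose
coproduct and counit are multiplicative. -/
class NonunitalBialgebra (K V : Type*) [Field K] [NonUnitalRing V] [Module K V]
    [IsScalarTower K V V] [SMulCommClass K V V] [Coalgebra K V] : Prop where
  comul_mul : ∀ v w : V,
    Coalgebra.comul (R := K) (v * w) = Coalgebra.comul (R := K) v * Coalgebra.comul (R := K) w
  counit_mul : ∀ v w : V,
    Coalgebra.counit (R := K) (v * w) = Coalgebra.counit (R := K) v * Coalgebra.counit (R := K) w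

/-! ### The unitary extension `uV = K ⊕ V` -/

section UnitaryExtension

variable (K V : Type*) [Field K] [NonUnitalCommRing V] [Module K V]
  [IsScalarTower K V V] [SMulCommClass K V V]

/-- The inclusion `V ⊗ V → uV ⊗ uV`. -/
def inrTensor : V ⊗[K] V →ₗ[K] Unitization K V ⊗[K] Unitization K V :=
  TensorProduct.map (Unitization.inrHom K K V) (Unitization.inrHom K K V)

lemma inrTensor_mul (x y : V ⊗[K] V) :
    inrTensor K V (x * y) = inrTensor K V x * inrTensor K V y := by
  induction x with
  | zero => simp
  | add x₁ x₂ h₁ h₂ => simp only [add_mul, map_add, h₁, h₂]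
  | tmul a b =>
    induction y with
    | zero => simp
    | add y₁ y₂ h₁ h₂ => simp only [mul_add, map_add, h₁, h₂]
    | tmul c d => simp [inrTensor]

variable [Coalgebra K V] [NonunitalBialgebra K V]

/-- The coproduct of `uV`: `δ(l + v) = l 1 ⊗ 1 + δ_V(v)`. -/
def uComul : Unitization K V →ₐ[K] Unitization K V ⊗[K] Unitization K V :=
  Unitization.lift
    { toFun := fun v => inrTensor K V (Coalgebra.comul (R := K) v)
      map_smul' := by intro c v; simp
      map_zero' := by simp
      map_add' := by intro v w; simp
      map_mul' := by
        intro v w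
        rw [NonunitalBialgebra.comul_mul, inrTensor_mul] }

/-- The counit of `uV`: `ε(l + v) = l + ε_V(v)`. -/
def uCounit : Unitization K V →ₐ[K] K :=
  Unitization.lift
    { toFun := fun v => Coalgebra.counit (R := K) v
      map_smul' := by intro c v; simp
      map_zero' := by simp
      map_add' := by intro v w; simp
      map_mul' := fun v w => NonunitalBialgebra.counit_mul v w }

end UnitaryExtension

/-! ### Bialgebras over a bialgebra, double bialgebras, connectedness -/

section Bialgebras

variable {K B C : Type*} [Field K] [Ring B] [Bialgebra K B] [Ring C] [Algebra K C]

/-- `b₁ ⊗ c₂ ⊗ b₃ ⊗ c₄ ↦ b₁ ⊗ b₃ ⊗ c₂ c₄`. -/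
def mul1324 (K B C : Type*) [Field K] [Ring B] [Algebra K B] [Ring C] [Algebra K C] :
    (B ⊗[K] C) ⊗[K] (B ⊗[K] C) →ₗ[K] (B ⊗[K] B) ⊗[K] C :=
  TensorProduct.map LinearMap.id (LinearMap.mul' K C) ∘ₗ
    (TensorProduct.tensorTensorTensorComm K B C B C).toLinearMap

/-- Given a unitary algebra `C` with a coproduct `δC` and a counit `εC`, the map `ρ` is a right
coaction of `C` on `B` making the bialgebra `B` (with its coproduct `Δ`) a bialgebra in the category
of right `C`-comodules. That the unit and the product of `B` are comodule morphisms is expressed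
by `ρ` being an algebra morphism. -/
structure IsBialgebraOver (δC : C →ₐ[K] C ⊗[K] C) (εC : C →ₐ[K] K) (ρ : B →ₐ[K] B ⊗[K] C) :
    Prop where
  coassoc : ∀ x : B,
    TensorProduct.assoc K B C C (LinearMap.rTensor C ρ.toLinearMap (ρ x)) =
      LinearMap.lTensor B δC.toLinearMap (ρ x)
  counit : ∀ x : B, TensorProduct.rid K B (LinearMap.lTensor B εC.toLinearMap (ρ x)) = x
  counit_comodule : ∀ x : B,
    TensorProduct.lid K C (LinearMap.rTensor C (Coalgebra.counit (R := K) (A := B)) (ρ x)) =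
      algebraMap K C (Coalgebra.counit (R := K) x)
  comul_comodule : ∀ x : B,
    LinearMap.rTensor C (Coalgebra.comul (R := K) (A := B)) (ρ x) =
      mul1324 K B C
        (TensorProduct.map ρ.toLinearMap ρ.toLinearMap (Coalgebra.comul (R := K) x))

/-- A double bialgebra structure `(B, m, Δ, δ)` on the bialgebra `(B, m, Δ)`: a second coproduct
`δ`, with counit `ε_δ`, such that `(B, m, δ)` is a bialgebra and `(B, m, Δ)` is a bialgebra in
the category of right `(B, m, δ)`-comodules, with the coaction `δ`. -/
structure DoubleBialgebra (K B : Type*) [Field K] [Ring B] [Bialgebra K B] where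
  /-- the second coproduct -/
  δ : B →ₐ[K] B ⊗[K] B
  /-- its counit -/
  εδ : B →ₐ[K] K
  counit_left : ∀ x : B, TensorProduct.lid K B (LinearMap.rTensor B εδ.toLinearMap (δ x)) = x
  isBialgebraOver : IsBialgebraOver δ εδ δ

variable (K B) in
/-- `x ↦ Δ(x) - x ⊗ 1 - 1 ⊗ x`, which is the reduced coproduct on the kernel of the counit. -/
def reducedComul : B →ₗ[K] B ⊗[K] B :=
  Coalgebra.comul - (TensorProduct.mk K B B).flip 1 - TensorProduct.mk K B B 1

variable (K B) in
/-- The iterated reduced coproduct: index `0` is the identity, index `n + 1` is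
`(index n ⊗ Id) ∘ reducedComul`. Index `n` takes its values in `B^{⊗(n+1)}`, seen inside the tensor
algebra of `B`. -/
def iterReducedComul : ℕ → B →ₗ[K] TensorAlgebra K B
  | 0 => TensorAlgebra.ι K
  | n + 1 => LinearMap.mul' K (TensorAlgebra K B) ∘ₗ
      TensorProduct.map (iterReducedComul n) (TensorAlgebra.ι K) ∘ₗ reducedComul K B

/-- The bialgebra `(B, m, Δ)` is connected: every element of the kernel of the counit is killed by
some iterated reduced coproduct. -/
def IsConnectedBialgebra (K B : Type*) [Field K] [Ring B] [Bialgebra K B] : Prop :=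
  ∀ x : B, Coalgebra.counit (R := K) x = 0 → ∃ n : ℕ, iterReducedComul K B n x = 0

variable {V : Type*} [NonUnitalCommRing V] [Module K V]
  [IsScalarTower K V V] [SMulCommClass K V V] [Coalgebra K V] [NonunitalBialgebra K V]

/-- `(B, m, Δ, ρ)` is a bialgebra over the nonunitary bialgebra `V`: a bialgebra over `uV` such that
`ρ(ker ε_Δ) ⊆ B ⊗ V`. -/
structure IsBialgebraOverNonunital (ρ : B →ₐ[K] B ⊗[K] Unitization K V) : Prop where
  toOver : IsBialgebraOver (uComul K V) (uCounit K V) ρ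
  ker_counit : ∀ x : B, Coalgebra.counit (R := K) x = 0 →
    ρ x ∈ LinearMap.range (LinearMap.lTensor B (Unitization.inrHom K K V))

/-- `(B, m, Δ, δ, ρ)` is a double bialgebra over the nonunitary bialgebra `V`; in particular
`(Id ⊗ c) ∘ (ρ ⊗ Id) ∘ δ = (δ ⊗ Id) ∘ ρ` as maps `B → B ⊗ B ⊗ uV`. -/
structure IsDoubleBialgebraOver (D : DoubleBialgebra K B)
    (ρ : B →ₐ[K] B ⊗[K] Unitization K V) : Prop where
  toOver : IsBialgebraOverNonunital ρ
  compat : ∀ x : B,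
    TensorProduct.rightComm K B (Unitization K V) B (LinearMap.rTensor B ρ.toLinearMap (D.δ x)) =
      LinearMap.rTensor (Unitization K V) D.δ.toLinearMap (ρ x)

end Bialgebras

/-! ### Quasishuffle double bialgebras

The underlying space of `QSh(V)` is `TensorAlgebra K V`; its multiplication `*` in Mathlib is the
concatenation of words, and `ι K v` is the one-letter word `v`. -/

namespace QSh

variable {K V : Type*} [Field K]

section Words

variable [AddCommGroup V] [Module K V] {W : Type*} [AddCommGroup W] [Module K W]

/-- Induction on words, by adding a first letter. -/
theorem word_induction {P : TensorAlgebra K V → Prop} (h1 : P 1)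
    (hadd : ∀ u w, P u → P w → P (u + w)) (hsmul : ∀ (c : K) w, P w → P (c • w))
    (hcons : ∀ (v : V) w, P w → P (TensorAlgebra.ι K v * w)) (w : TensorAlgebra K V) : P w := by
  have key : ∀ u : (TensorAlgebra K V), ∀ w : (TensorAlgebra K V), P w → P (u * w) := by
    intro u
    induction u using TensorAlgebra.induction with
    | algebraMap r => intro w hw; rw [← Algebra.smul_def]; exact hsmul r w hw
    | ι v => exact hcons v
    | mul a b ha hb => intro w hw; rw [mul_assoc]; exact ha _ (hb _ hw)
    | add a b ha hb => intro w hw; rw [add_mul]; exact hadd _ _ (ha _ hw) (hb _ hw)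
  simpa using key w 1 h1

/-- The linear map `f` on words with `f 1 = w₀` and `f (y w) = s y (w, f w)`. -/
def wordRec (w₀ : W) (s : V →ₗ[K] (TensorAlgebra K V × W) →ₗ[K] W) :
    TensorAlgebra K V →ₗ[K] W :=
  LinearMap.snd K (TensorAlgebra K V) W ∘ₗ
    LinearMap.applyₗ ((1, w₀) : (TensorAlgebra K V) × W) ∘ₗ
      (TensorAlgebra.lift K
        (A := Module.End K ((TensorAlgebra K V) × W))
        { toFun := fun y =>
            ((LinearMap.mulLeft K (TensorAlgebra.ι K y : (TensorAlgebra K V))) ∘ₗ LinearMap.fst K (TensorAlgebra K V) W).prod (s y)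
          map_add' := by intro y z; ext <;> simp [add_mul]
          map_smul' := by intro c y; ext <;> simp }).toLinearMap

theorem wordRec_one (w₀ : W) (s : V →ₗ[K] (TensorAlgebra K V × W) →ₗ[K] W) :
    wordRec w₀ s 1 = w₀ := by
  simp [wordRec]

theorem wordRec_cons (w₀ : W) (s : V →ₗ[K] (TensorAlgebra K V × W) →ₗ[K] W) (y : V)
    (w : TensorAlgebra K V) : wordRec w₀ s (TensorAlgebra.ι K y * w) = s y (w, wordRec w₀ s w) := by
  have key : ∀ w : (TensorAlgebra K V), ((TensorAlgebra.lift K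
        (A := Module.End K ((TensorAlgebra K V) × W))
        { toFun := fun y =>
            ((LinearMap.mulLeft K (TensorAlgebra.ι K y : (TensorAlgebra K V))) ∘ₗ LinearMap.fst K (TensorAlgebra K V) W).prod (s y)
          map_add' := by intro y z; ext <;> simp [add_mul]
          map_smul' := by intro c y; ext <;> simp }) w (1, w₀)).1 = w := by
    intro w
    induction w using word_induction with
    | h1 => simp
    | hadd u w hu hw => simp [hu, hw]
    | hsmul c w hw => simp [hw]
    | hcons v w hw => simp [hw]
  simp only [wordRec, LinearMap.comp_apply, AlgHom.toLinearMap_apply, map_mul,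
    TensorAlgebra.lift_ι_apply, LinearMap.applyₗ_apply_apply, Module.End.mul_apply]
  refine congrArg (s y) (Prod.ext ?_ rfl)
  exact key w

variable (K V) in
/-- The deconcatenation coproduct `Δ`: `Δ(1) = 1 ⊗ 1` and
`Δ(y w) = 1 ⊗ y w + (y ⊗ 1) Δ(w)`. -/
def comul : TensorAlgebra K V →ₗ[K] TensorAlgebra K V ⊗[K] TensorAlgebra K V :=
  wordRec (1 ⊗ₜ 1)
    { toFun := fun y =>
        (TensorProduct.mk K (TensorAlgebra K V) (TensorAlgebra K V) 1 ∘ₗ LinearMap.mulLeft K (TensorAlgebra.ι K y : (TensorAlgebra K V))) ∘ₗ LinearMap.fst K _ _ +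
          LinearMap.rTensor (TensorAlgebra K V) (LinearMap.mulLeft K (TensorAlgebra.ι K y : (TensorAlgebra K V))) ∘ₗ LinearMap.snd K _ _
      map_add' := by
        intro y z
        ext <;> simp [add_mul, TensorProduct.add_tmul, TensorProduct.tmul_add]
      map_smul' := by
        intro c y
        ext <;> simp [TensorProduct.smul_tmul'] }

theorem comul_one : comul K V 1 = 1 ⊗ₜ 1 := wordRec_one _ _

theorem comul_cons (y : V) (w : TensorAlgebra K V) :
    comul K V (TensorAlgebra.ι K y * w) = 1 ⊗ₜ (TensorAlgebra.ι K y * w) + LinearMap.rTensor (TensorAlgebra K V) (LinearMap.mulLeft K (TensorAlgebra.ι K y : (TensorAlgebra K V)))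
      (comul K V w) := wordRec_cons _ _ _ _

variable (K V) in
/-- The counit `ε_Δ` of the deconcatenation: `1` on the empty word, `0` on the other words. -/
def counit : TensorAlgebra K V →ₗ[K] K := TensorAlgebra.algebraMapInv.toLinearMap

theorem counit_comul_left (w : TensorAlgebra K V) :
    LinearMap.rTensor _ (counit K V) (comul K V w) = 1 ⊗ₜ w := by
  induction w using word_induction with
  | h1 => simp [comul_one, counit]
  | hadd u w hu hw => simp only [map_add, hu, hw, TensorProduct.tmul_add]
  | hsmul c w hw => simp only [map_smul, hw, TensorProduct.tmul_smul]
  | hcons y w hw =>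
    have : counit K V ∘ₗ LinearMap.mulLeft K (TensorAlgebra.ι K y) = 0 := by
      ext u; simp [counit, TensorAlgebra.algebraMapInv]
    rw [comul_cons, map_add, ← LinearMap.comp_apply (LinearMap.rTensor _ (counit K V)),
      ← LinearMap.rTensor_comp, this]
    simp [counit]

end Words

variable [NonUnitalCommRing V] [Module K V] [SMulCommClass K V V]

/-- For a letter `x` and `f = (v ⊔ ·)`, the map `g = (x v ⊔ ·)`, that is to say
`g 1 = x f(1)` and `g (y w) = x f(y w) + y g(w) + (x · y) f(w)`. -/
def mulConsAux (x : V) (f : TensorAlgebra K V →ₗ[K] TensorAlgebra K V) :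
    TensorAlgebra K V →ₗ[K] TensorAlgebra K V :=
  wordRec (TensorAlgebra.ι K x * f 1)
    { toFun := fun y =>
        (LinearMap.mulLeft K (TensorAlgebra.ι K x : (TensorAlgebra K V)) ∘ₗ f ∘ₗ LinearMap.mulLeft K (TensorAlgebra.ι K y : (TensorAlgebra K V)) +
            LinearMap.mulLeft K (TensorAlgebra.ι K (x * y) : (TensorAlgebra K V)) ∘ₗ f) ∘ₗ LinearMap.fst K _ _ +
          LinearMap.mulLeft K (TensorAlgebra.ι K y : (TensorAlgebra K V)) ∘ₗ LinearMap.snd K _ _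
      map_add' := by
        intro y z
        apply LinearMap.ext
        rintro ⟨u, w⟩
        simp only [LinearMap.add_apply, LinearMap.comp_apply, LinearMap.fst_apply,
          LinearMap.snd_apply, LinearMap.mulLeft_apply, map_add, mul_add, add_mul]
        abel
      map_smul' := by
        intro c y
        apply LinearMap.ext
        rintro ⟨u, w⟩
        simp [mul_smul_comm] }

theorem mulConsAux_one (x : V) (f : TensorAlgebra K V →ₗ[K] TensorAlgebra K V) :
    mulConsAux x f 1 = TensorAlgebra.ι K x * f 1 := wordRec_one _ _

theorem mulConsAux_cons (x : V) (f : TensorAlgebra K V →ₗ[K] TensorAlgebra K V) (y : V)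
    (w : TensorAlgebra K V) :
    mulConsAux x f (TensorAlgebra.ι K y * w) =
      TensorAlgebra.ι K x * f (TensorAlgebra.ι K y * w) + TensorAlgebra.ι K (x * y) * f w + TensorAlgebra.ι K y * mulConsAux x f w := wordRec_cons _ _ _ _

variable [IsScalarTower K V V]

variable (K V) in
/-- `mulConsAux` is bilinear. -/
def mulCons : V →ₗ[K] Module.End K (TensorAlgebra K V) →ₗ[K] Module.End K (TensorAlgebra K V) :=
  LinearMap.mk₂ K (fun x f => mulConsAux x f)
    (by
      intro x x' f
      ext w
      simp only [LinearMap.add_apply]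
      induction w using word_induction with
      | h1 => simp [mulConsAux_one, add_mul]
      | hadd u w hu hw => simp only [map_add, hu, hw]; abel
      | hsmul c w hw => simp only [map_smul, hw, smul_add]
      | hcons v w hw => simp only [mulConsAux_cons, hw, map_add, add_mul, mul_add]; abel)
    (by
      intro c x f
      ext w
      simp only [LinearMap.smul_apply]
      induction w using word_induction with
      | h1 => simp [mulConsAux_one]
      | hadd u w hu hw => simp only [map_add, hu, hw, smul_add]
      | hsmul d w hw => simp only [map_smul, hw, smul_comm c d]
      | hcons v w hw => simp [mulConsAux_cons, hw, smul_mul_assoc])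
    (by
      intro x f f'
      ext w
      simp only [LinearMap.add_apply]
      induction w using word_induction with
      | h1 => simp [mulConsAux_one, mul_add]
      | hadd u w hu hw => simp only [map_add, hu, hw]; abel
      | hsmul c w hw => simp only [map_smul, hw, smul_add]
      | hcons v w hw => simp only [mulConsAux_cons, hw, LinearMap.add_apply, mul_add]; abel)
    (by
      intro c x f
      ext w
      simp only [LinearMap.smul_apply]
      induction w using word_induction with
      | h1 => simp [mulConsAux_one]
      | hadd u w hu hw => simp only [map_add, hu, hw, smul_add]
      | hsmul d w hw => simp only [map_smul, hw, smul_comm c d]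
      | hcons v w hw => simp [mulConsAux_cons, hw])

variable (K V) in
/-- The quasishuffle product `⊔` of `QSh(V)`; it is characterised by `one_qmul`, `qmul_one` and
`cons_qmul_cons` below. -/
def qmul : TensorAlgebra K V →ₗ[K] TensorAlgebra K V →ₗ[K] TensorAlgebra K V :=
  LinearMap.applyₗ (LinearMap.id : Module.End K (TensorAlgebra K V)) ∘ₗ
    (TensorAlgebra.lift K (A := Module.End K (Module.End K (TensorAlgebra K V))) (mulCons K V)).toLinearMap

theorem one_qmul (w : TensorAlgebra K V) : qmul K V 1 w = w := by simp [qmul]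

theorem cons_qmul (x : V) (v : TensorAlgebra K V) :
    qmul K V (TensorAlgebra.ι K x * v) = mulConsAux x (qmul K V v) := by
  simp only [qmul, LinearMap.comp_apply, AlgHom.toLinearMap_apply, map_mul,
    TensorAlgebra.lift_ι_apply, LinearMap.applyₗ_apply_apply, Module.End.mul_apply]
  rfl

theorem qmul_one (v : TensorAlgebra K V) : qmul K V v 1 = v := by
  induction v using word_induction with
  | h1 => exact one_qmul 1
  | hadd u w hu hw => simp [hu, hw]
  | hsmul c w hw => simp [hw]
  | hcons x w hw => rw [cons_qmul, mulConsAux_one, hw]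

/-- `x v ⊔ y w = x (v ⊔ y w) + y (x v ⊔ w) + (x · y) (v ⊔ w)`. -/
theorem cons_qmul_cons (x y : V) (v w : TensorAlgebra K V) :
    qmul K V (TensorAlgebra.ι K x * v) (TensorAlgebra.ι K y * w) = TensorAlgebra.ι K x * qmul K V v (TensorAlgebra.ι K y * w) + TensorAlgebra.ι K y * qmul K V (TensorAlgebra.ι K x * v) w +
      TensorAlgebra.ι K (x * y) * qmul K V v w := by
  rw [cons_qmul, mulConsAux_cons]
  abel

variable [Coalgebra K V]

variable (K V) in
/-- The coaction `ρ(v₁ … vₙ) = v₁' … vₙ' ⊗ v₁'' · … · vₙ''` of `uV`: it is multiplicative for the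
concatenation. -/
def coaction : TensorAlgebra K V →ₗ[K] TensorAlgebra K V ⊗[K] Unitization K V :=
  (TensorAlgebra.lift K
    (TensorProduct.map (TensorAlgebra.ι K) (Unitization.inrHom K K V) ∘ₗ
      (Coalgebra.comul : V →ₗ[K] V ⊗[K] V))).toLinearMap

variable (K V) in
/-- The counit `ε_δ`: `1` on the empty word, `ε_V` on one-letter words, `0` on longer words. -/
def counitδ : TensorAlgebra K V →ₗ[K] K :=
  wordRec 1
    { toFun := fun y => Coalgebra.counit (R := K) y • (counit K V ∘ₗ LinearMap.fst K _ _)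
      map_add' := by intro y z; simp [add_smul]
      map_smul' := by intro c y; simp [mul_smul] }

variable (K V) in
/-- `a ⊗ b ↦ (d ↦ a ⊗ b ⊗ d)`: opens a new first block. -/
def openBlock : V ⊗[K] V →ₗ[K] TensorAlgebra K V ⊗[K] TensorAlgebra K V →ₗ[K]
    (V ⊗[K] TensorAlgebra K V) ⊗[K] (TensorAlgebra K V ⊗[K] TensorAlgebra K V) :=
  TensorProduct.mk K _ _ ∘ₗ TensorProduct.map LinearMap.id (TensorAlgebra.ι K)

variable (K V) in
/-- `a ⊗ b ↦ (c ⊗ u ⊗ d ↦ (a · c) ⊗ b u ⊗ d)`: adds a letter to the first block. -/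
def extendBlock : V ⊗[K] V →ₗ[K]
    (V ⊗[K] TensorAlgebra K V) ⊗[K] (TensorAlgebra K V ⊗[K] TensorAlgebra K V) →ₗ[K]
    (V ⊗[K] TensorAlgebra K V) ⊗[K] (TensorAlgebra K V ⊗[K] TensorAlgebra K V) :=
  LinearMap.rTensorHom _ ∘ₗ TensorProduct.homTensorHomMap (.id K) V (TensorAlgebra K V) V (TensorAlgebra K V) ∘ₗ
    TensorProduct.map (LinearMap.mul K V) (LinearMap.mul K (TensorAlgebra K V) ∘ₗ TensorAlgebra.ι K)

variable (K V) in
/-- `c ⊗ u ⊗ (l ⊗ r) ↦ c l ⊗ (u ⊔ r)`: closes the first block. -/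
def closeBlock :
    (V ⊗[K] TensorAlgebra K V) ⊗[K] (TensorAlgebra K V ⊗[K] TensorAlgebra K V) →ₗ[K]
    TensorAlgebra K V ⊗[K] TensorAlgebra K V :=
  TensorProduct.map
      (LinearMap.mul' K (TensorAlgebra K V) ∘ₗ TensorProduct.map (TensorAlgebra.ι K) LinearMap.id)
      (TensorProduct.lift (qmul K V)) ∘ₗ
    (TensorProduct.tensorTensorTensorComm K V (TensorAlgebra K V) (TensorAlgebra K V) (TensorAlgebra K V)).toLinearMap

variable (K V) in
/-- Reads a word letter by letter, from the last letter to the first one, and computes the pair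
`(D(w), δ(w))`: here `D(w)` is the sum over the nonempty prefixes `v₁ … vᵢ` of `w = v₁ … vₖ` of
`(v₁' · … · vᵢ') ⊗ v₁'' … vᵢ'' ⊗ δ(vᵢ₊₁ … vₖ)`, and `δ(w)` is obtained from `D(w)` by closing the
first block, except that `δ(1) = 1 ⊗ 1`. -/
def deltaAux : TensorAlgebra K V →ₗ[K]
    ((V ⊗[K] TensorAlgebra K V) ⊗[K] (TensorAlgebra K V ⊗[K] TensorAlgebra K V)) ×
      (TensorAlgebra K V ⊗[K] TensorAlgebra K V) :=
  LinearMap.applyₗ (0, 1 ⊗ₜ 1) ∘ₗ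
    (TensorAlgebra.lift K
      (A := Module.End K
        (((V ⊗[K] TensorAlgebra K V) ⊗[K] (TensorAlgebra K V ⊗[K] TensorAlgebra K V)) ×
          (TensorAlgebra K V ⊗[K] TensorAlgebra K V)))
      { toFun := fun y =>
          (LinearMap.id.prod (closeBlock K V)) ∘ₗ
            (extendBlock K V (Coalgebra.comul (R := K) y)).coprod
              (openBlock K V (Coalgebra.comul (R := K) y))
        map_add' := by
          intro y z
          apply LinearMap.ext
          rintro ⟨m, d⟩
          simp only [map_add, LinearMap.comp_apply, LinearMap.coprod_apply, LinearMap.add_apply]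
          abel
        map_smul' := by
          intro c y
          apply LinearMap.ext
          rintro ⟨m, d⟩
          simp only [map_smul, map_add, LinearMap.comp_apply, LinearMap.coprod_apply,
            LinearMap.smul_apply, RingHom.id_apply, smul_add] }).toLinearMap

variable (K V) in
/-- The second coproduct of `QSh(V)`:
`δ(v₁ … vₖ)` is the sum over the ways of cutting `v₁ … vₖ` into nonempty blocks of consecutive
letters of `(∏ v' of block 1) … (∏ v' of block p) ⊗ (v'' of block 1) ⊔ … ⊔ (v'' of block p)`. -/
def delta : TensorAlgebra K V →ₗ[K] TensorAlgebra K V ⊗[K] TensorAlgebra K V :=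
  LinearMap.snd K _ _ ∘ₗ deltaAux K V

variable (K V) in
/-- One block: `v₁ … vₘ ↦ (v₁' · … · vₘ') ⊗ v₁'' … vₘ''` if `m ≥ 1`, and `1 ↦ 0`. -/
def block : TensorAlgebra K V →ₗ[K] V ⊗[K] TensorAlgebra K V :=
  LinearMap.rTensor _ (Unitization.sndHom K K V) ∘ₗ
    (TensorAlgebra.lift K
      (TensorProduct.map (Unitization.inrHom K K V) (TensorAlgebra.ι K) ∘ₗ
        (Coalgebra.comul : V →ₗ[K] V ⊗[K] V))).toLinearMap

theorem block_one : block K V 1 = 0 := by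
  simp [block, Algebra.TensorProduct.one_def]

theorem block_cons (y : V) (u : TensorAlgebra K V) :
    block K V (TensorAlgebra.ι K y * u) =
      TensorProduct.map₂ (LinearMap.mul K V)
          (LinearMap.mul K (TensorAlgebra K V) ∘ₗ TensorAlgebra.ι K)
          (Coalgebra.comul (R := K) y) (block K V u) +
        counit K V u • LinearMap.lTensor V (TensorAlgebra.ι K) (Coalgebra.comul (R := K) y) := by
  set L := TensorAlgebra.lift K
      (TensorProduct.map (Unitization.inrHom K K V) (TensorAlgebra.ι K) ∘ₗ
        (Coalgebra.comul : V →ₗ[K] V ⊗[K] V)) with hL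
  have hb : ∀ w, block K V w = LinearMap.rTensor _ (Unitization.sndHom K K V) (L w) :=
    fun w => rfl
  have hfst : ∀ w, TensorProduct.lid K _
      (LinearMap.rTensor _ (Unitization.fstHom K V).toLinearMap (L w)) = counit K V w • 1 := by
    have : ((Algebra.TensorProduct.lid K (TensorAlgebra K V)).toAlgHom.comp
        (Algebra.TensorProduct.map (Unitization.fstHom K V) (AlgHom.id K _))).comp L =
        (Algebra.ofId K _).comp TensorAlgebra.algebraMapInv := by
      ext v
      simp only [hL, LinearMap.comp_apply, AlgHom.toLinearMap_apply, AlgHom.comp_apply,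
        TensorAlgebra.lift_ι_apply]
      generalize (Coalgebra.comul (R := K) v : V ⊗[K] V) = X
      induction X with
      | zero => simp [TensorAlgebra.algebraMapInv]
      | tmul a b => simp [TensorAlgebra.algebraMapInv]
      | add a b ha hb => simp only [map_add, ha, hb]; simp [TensorAlgebra.algebraMapInv]
    intro w
    have h := DFunLike.congr_fun this w
    rw [← Algebra.algebraMap_eq_smul_one]
    exact h
  have key : ∀ (X : V ⊗[K] V) (Y : Unitization K V ⊗[K] TensorAlgebra K V),
      LinearMap.rTensor _ (Unitization.sndHom K K V)
        (TensorProduct.map (Unitization.inrHom K K V) (TensorAlgebra.ι K) X * Y) =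
      TensorProduct.map₂ (LinearMap.mul K V)
          (LinearMap.mul K (TensorAlgebra K V) ∘ₗ TensorAlgebra.ι K) X
          (LinearMap.rTensor _ (Unitization.sndHom K K V) Y) +
        TensorProduct.map₂ (LinearMap.lsmul K V).flip
          (LinearMap.mul K (TensorAlgebra K V) ∘ₗ TensorAlgebra.ι K) X
          (LinearMap.rTensor _ (Unitization.fstHom K V).toLinearMap Y) := by
    intro X Y
    induction X with
    | zero => simp
    | add a b ha hb =>
      simp only [map_add, add_mul, LinearMap.add_apply, ha, hb]; abel
    | tmul a b =>
      induction Y with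
      | zero => simp
      | add c d hc hd => simp only [map_add, mul_add, hc, hd]; abel
      | tmul c d => simp [TensorProduct.add_tmul, add_comm]
  have h1 : LinearMap.rTensor _ (Unitization.fstHom K V).toLinearMap (L u) =
      1 ⊗ₜ (counit K V u • 1) := by
    apply (TensorProduct.lid K (TensorAlgebra K V)).injective
    rw [hfst]
    simp
  rw [hb, hb, map_mul]
  have h2 : L (TensorAlgebra.ι K y) = TensorProduct.map (Unitization.inrHom K K V)
      (TensorAlgebra.ι K) (Coalgebra.comul (R := K) y) := by simp [hL]
  rw [h2, key, h1]
  congr 1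
  generalize (Coalgebra.comul (R := K) y : V ⊗[K] V) = X
  induction X with
  | zero => simp
  | tmul a b => simp
  | add a b ha hb => simp only [map_add, LinearMap.add_apply, ha, hb, smul_add]

theorem deltaAux_one : deltaAux K V 1 = (0, 1 ⊗ₜ 1) := by simp [deltaAux]

theorem deltaAux_cons_fst (y : V) (w : TensorAlgebra K V) :
    (deltaAux K V (TensorAlgebra.ι K y * w)).1 =
      extendBlock K V (Coalgebra.comul (R := K) y) (deltaAux K V w).1 +
        openBlock K V (Coalgebra.comul (R := K) y) (delta K V w) := by
  simp [deltaAux, delta]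

theorem delta_cons (y : V) (w : TensorAlgebra K V) :
    delta K V (TensorAlgebra.ι K y * w) =
      closeBlock K V (deltaAux K V (TensorAlgebra.ι K y * w)).1 := by
  simp [deltaAux, delta]

theorem delta_one : delta K V 1 = 1 ⊗ₜ 1 := by simp [delta, deltaAux_one]

theorem deltaAux_fst_eq (w : TensorAlgebra K V) :
    (deltaAux K V w).1 = TensorProduct.map (block K V) (delta K V) (comul K V w) := by
  induction w using word_induction with
  | h1 => simp [deltaAux_one, comul_one, block_one]
  | hadd u w hu hw => simp only [map_add, Prod.fst_add, hu, hw]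
  | hsmul c w hw => simp only [map_smul, Prod.smul_fst, hw]
  | hcons y w hw =>
    have h : ∀ Z : TensorAlgebra K V ⊗[K] TensorAlgebra K V,
        TensorProduct.map (block K V) (delta K V)
          (LinearMap.rTensor _ (LinearMap.mulLeft K (TensorAlgebra.ι K y)) Z) =
        extendBlock K V (Coalgebra.comul (R := K) y)
            (TensorProduct.map (block K V) (delta K V) Z) +
          openBlock K V (Coalgebra.comul (R := K) y)
            (delta K V (TensorProduct.lid K _ (LinearMap.rTensor _ (counit K V) Z))) := by
      intro Z
      induction Z with
      | zero => simp
      | add a b ha hb => simp only [map_add, ha, hb]; abel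
      | tmul a b =>
        simp only [LinearMap.rTensor_tmul, TensorProduct.map_tmul, LinearMap.mulLeft_apply,
          block_cons, TensorProduct.add_tmul, TensorProduct.lid_tmul, map_smul]
        rw [TensorProduct.smul_tmul, TensorProduct.tmul_smul]
        rfl
    rw [comul_cons, map_add, h, deltaAux_cons_fst, hw, counit_comul_left]
    simp [block_one]

/-- `δ` is the sum, over the first block of letters, of what this block and the image under `δ` of
the other letters contribute: this is the recursive form of the sum over all decompositions of a
word into nonempty blocks. -/
theorem delta_eq (w : TensorAlgebra K V) :
    delta K V w = counit K V w • (1 ⊗ₜ 1) +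
      closeBlock K V (TensorProduct.map (block K V) (delta K V) (comul K V w)) := by
  rw [← deltaAux_fst_eq]
  induction w using word_induction with
  | h1 => simp [deltaAux_one, delta_one, counit]
  | hadd u w hu hw => simp only [map_add, Prod.fst_add, hu, hw, add_smul]; abel
  | hsmul c w hw => simp only [map_smul, Prod.smul_fst, hw, smul_add, smul_smul, smul_eq_mul]
  | hcons y w _ => rw [← delta_cons]; simp [counit, TensorAlgebra.algebraMapInv]

end QSh

/-! ### Morphisms to `QSh(V)`, and the action of the characters -/

section Morphisms

variable {K V B : Type*} [Field K] [NonUnitalCommRing V] [Module K V]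
  [IsScalarTower K V V] [SMulCommClass K V V] [Coalgebra K V] [Ring B] [Bialgebra K B]

/-- `φ` is a morphism of bialgebras over `V` from `(B, m, Δ, ρ)` to `QSh(V) = (T(V), ⊔, Δ, ρ)`. -/
structure IsBialgebraOverHom (ρ : B →ₐ[K] B ⊗[K] Unitization K V)
    (φ : B →ₗ[K] TensorAlgebra K V) : Prop where
  map_one : φ 1 = 1
  map_mul : ∀ x y : B, φ (x * y) = QSh.qmul K V (φ x) (φ y)
  map_counit : ∀ x : B, QSh.counit K V (φ x) = Coalgebra.counit (R := K) x
  map_comul : ∀ x : B,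
    QSh.comul K V (φ x) = TensorProduct.map φ φ (Coalgebra.comul (R := K) x)
  map_coaction : ∀ x : B, QSh.coaction K V (φ x) = LinearMap.rTensor (Unitization K V) φ (ρ x)

/-- `φ` is a morphism of double bialgebras over `V` from `(B, m, Δ, δ, ρ)` to
`QSh(V) = (T(V), ⊔, Δ, δ, ρ)`. -/
structure IsDoubleBialgebraOverHom (D : DoubleBialgebra K B)
    (ρ : B →ₐ[K] B ⊗[K] Unitization K V) (φ : B →ₗ[K] TensorAlgebra K V) : Prop extends
    IsBialgebraOverHom ρ φ where
  map_counitδ : ∀ x : B, QSh.counitδ K V (φ x) = D.εδ x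
  map_delta : ∀ x : B, QSh.delta K V (φ x) = TensorProduct.map φ φ (D.δ x)

/-- `φ ⇜ χ = (φ ⊗ χ) ∘ δ`. -/
def characterAct {W : Type*} [AddCommGroup W] [Module K W] (D : DoubleBialgebra K B)
    (φ : B →ₗ[K] W) (χ : B →ₐ[K] K) : B →ₗ[K] W :=
  (TensorProduct.rid K W).toLinearMap ∘ₗ TensorProduct.map φ χ.toLinearMap ∘ₗ D.δ.toLinearMap

end Morphisms

end

/-! A nonempty word is recovered from its deconcatenation: the only cut whose right factor is a
single letter is the one before the last letter. Hence a coalgebra map `φ : B → T(V)` is governed by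
its letter part `f = letter ∘ φ`, through `φ = ε 1 + snoc ∘ (φ ⊗ f) ∘ Δ`. Since `f 1 = 0` and `B` is
connected, this recursion has exactly one solution (`IsConnectedBialgebra.exists_eq_right`,
`IsConnectedBialgebra.eq_of_eq_right`).

On words, `letter = (ε_δ ⊗ snd) ∘ ρ`. If `φ` also respects `ρ` and `χ = ε_δ ∘ φ`, then `f = (χ ⊗
snd) ∘ ρ` on `B`, so `φ` is determined by the character `χ`. Conversely, any character `χ` yields
such an `f`, hence a `φ`. The product, `Δ` and `ρ` are respected because in each case both sides of
the identity solve the same recursion along `Δ`. This gives `exists_isBialgebraOverHom` and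
`IsBialgebraOverHom.eq_of_counitδ_eq`.

The morphism `φ₁` is the one attached to `χ = ε_δ` of `B`. Its compatibility with `δ` comes from the
recursion of `δ` on the first block: cocommutativity of `V` expresses a block through the coaction,
and the compatibility of `ρ` with `δ` identifies it with `(letter ∘ φ₁ ⊗ φ₁) ∘ δ`. Finally `ε_δ ∘
(φ₁ ⇜ χ) = χ` by the counit axiom of `δ`, and uniqueness gives the other composition. -/

noncomputable section

namespace QSh

variable {K V : Type*} [Field K]

/-! ### Words: the letter part, and reconstruction from the deconcatenation -/

section Words

variable [AddCommGroup V] [Module K V]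

theorem counit_one : counit K V 1 = 1 := by simp [counit]

theorem counit_cons (y : V) (w : TensorAlgebra K V) :
    counit K V (TensorAlgebra.ι K y * w) = 0 := by
  simp [counit, TensorAlgebra.algebraMapInv]

theorem counit_snoc (w : TensorAlgebra K V) (y : V) :
    counit K V (w * TensorAlgebra.ι K y) = 0 := by
  simp [counit, TensorAlgebra.algebraMapInv]

variable (K V) in
/-- The projection of words on the space of letters: it kills the empty word and the words of
length at least `2`. -/
def letter : TensorAlgebra K V →ₗ[K] V :=
  wordRec 0
    { toFun := fun y => LinearMap.toSpanSingleton K V y ∘ₗ counit K V ∘ₗ LinearMap.fst K _ _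
      map_add' := by intro y z; ext <;> simp
      map_smul' := by
        intro c y
        apply LinearMap.ext
        rintro ⟨u, w⟩
        simpa using smul_comm _ _ _ }

theorem letter_one : letter K V 1 = 0 := wordRec_one _ _

theorem letter_cons (y : V) (w : TensorAlgebra K V) :
    letter K V (TensorAlgebra.ι K y * w) = counit K V w • y := wordRec_cons _ _ _ _

theorem letter_ι (y : V) : letter K V (TensorAlgebra.ι K y) = y := by
  simpa [counit_one] using letter_cons y (1 : TensorAlgebra K V)

theorem letter_snoc (w : TensorAlgebra K V) (y : V) :
    letter K V (w * TensorAlgebra.ι K y) = counit K V w • y := by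
  induction w using word_induction with
  | h1 => simp [letter_ι, counit_one]
  | hadd u w hu hw => simp only [add_mul, map_add, hu, hw, add_smul]
  | hsmul c w hw => simp only [smul_mul_assoc, map_smul, hw, smul_eq_mul, mul_smul]
  | hcons z w hw => rw [mul_assoc, letter_cons, counit_snoc, counit_cons, zero_smul, zero_smul]

variable (K V) in
/-- `w ⊗ y ↦ w y`: appends a last letter. -/
def snoc : TensorAlgebra K V ⊗[K] V →ₗ[K] TensorAlgebra K V :=
  LinearMap.mul' K (TensorAlgebra K V) ∘ₗ LinearMap.lTensor _ (TensorAlgebra.ι K)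

@[simp] theorem snoc_tmul (w : TensorAlgebra K V) (y : V) :
    snoc K V (w ⊗ₜ y) = w * TensorAlgebra.ι K y := rfl

/-- Mirror image of `comul_cons`, needed because the recursion for morphisms peels off the last
letter. -/
theorem comul_snoc (w : TensorAlgebra K V) (y : V) :
    comul K V (w * TensorAlgebra.ι K y) = (w * TensorAlgebra.ι K y) ⊗ₜ 1 +
      LinearMap.lTensor _ (LinearMap.mulRight K (TensorAlgebra.ι K y)) (comul K V w) := by
  induction w using word_induction with
  | h1 =>
    have := comul_cons y (1 : TensorAlgebra K V)
    simp only [mul_one, comul_one, LinearMap.rTensor_tmul, LinearMap.mulLeft_apply] at this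
    simp [this, comul_one, add_comm]
  | hadd u w hu hw => simp only [add_mul, map_add, hu, hw, TensorProduct.add_tmul]; abel
  | hsmul c w hw =>
    simp only [smul_mul_assoc, map_smul, hw, smul_add, TensorProduct.smul_tmul']
  | hcons z w hw =>
    have h : ∀ Z : TensorAlgebra K V ⊗[K] TensorAlgebra K V,
        LinearMap.rTensor _ (LinearMap.mulLeft K (TensorAlgebra.ι K z))
          (LinearMap.lTensor _ (LinearMap.mulRight K (TensorAlgebra.ι K y)) Z) =
        LinearMap.lTensor _ (LinearMap.mulRight K (TensorAlgebra.ι K y))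
          (LinearMap.rTensor _ (LinearMap.mulLeft K (TensorAlgebra.ι K z)) Z) := by
      intro Z
      rw [← LinearMap.comp_apply, ← LinearMap.comp_apply, LinearMap.rTensor_comp_lTensor,
        LinearMap.lTensor_comp_rTensor]
    rw [mul_assoc, comul_cons, hw, comul_cons, map_add, h, map_add]
    simp only [LinearMap.rTensor_tmul, LinearMap.lTensor_tmul, LinearMap.mulLeft_apply,
      LinearMap.mulRight_apply, mul_assoc]
    abel

/-- Among the cuts of `w y`, only the one before `y` has a right factor of length one. -/
theorem lTensor_letter_comul_snoc (z : TensorAlgebra K V ⊗[K] V) :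
    LinearMap.lTensor _ (letter K V) (comul K V (snoc K V z)) = z := by
  induction z with
  | zero => simp
  | add a b ha hb => simp only [map_add, ha, hb]
  | tmul w y =>
    have h : letter K V ∘ₗ LinearMap.mulRight K (TensorAlgebra.ι K y) =
        LinearMap.toSpanSingleton K V y ∘ₗ counit K V := by
      ext u; simp [letter_snoc]
    have hr : ∀ w : TensorAlgebra K V, LinearMap.lTensor _ (counit K V) (comul K V w) = w ⊗ₜ 1 := by
      intro w
      induction w using word_induction with
      | h1 => simp [comul_one, counit_one]
      | hadd u w hu hw => simp only [map_add, hu, hw, TensorProduct.add_tmul]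
      | hsmul c w hw => simp only [map_smul, hw, TensorProduct.smul_tmul']
      | hcons y w hw =>
        rw [comul_cons, map_add, ← LinearMap.comp_apply (LinearMap.lTensor _ _)
          (LinearMap.rTensor _ _), LinearMap.lTensor_comp_rTensor, ← LinearMap.rTensor_comp_lTensor,
          LinearMap.comp_apply, hw]
        simp [counit_cons]
    rw [snoc_tmul, comul_snoc, map_add, ← LinearMap.comp_apply (LinearMap.lTensor _ (letter K V))
      (LinearMap.lTensor _ _), ← LinearMap.lTensor_comp, h, LinearMap.lTensor_comp,
      LinearMap.comp_apply, hr]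
    simp [letter_one]

/-- Used with the space of letters `B`: it turns the vanishing of an iterated reduced coproduct,
computed in the tensor algebra, into the vanishing of a tensor. -/
theorem snoc_injective : Function.Injective (snoc K V) :=
  Function.LeftInverse.injective (g := LinearMap.lTensor _ (letter K V) ∘ comul K V)
    lTensor_letter_comul_snoc

/-- Cutting before the last letter and gluing back gives the word again. This identity is the source
of the recursion satisfied by every coalgebra map into words. -/
theorem eq_counit_add_snoc (w : TensorAlgebra K V) :
    w = counit K V w • 1 + snoc K V (LinearMap.lTensor _ (letter K V) (comul K V w)) := by
  induction w using word_induction with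
  | h1 => simp [counit_one, comul_one, letter_one]
  | hadd u w hu hw =>
    conv_lhs => rw [hu, hw]
    simp only [map_add, add_smul]; abel
  | hsmul c w hw =>
    conv_lhs => rw [hw]
    simp only [map_smul, smul_add, smul_smul, smul_eq_mul]
  | hcons y w hw =>
    have h : ∀ Z : TensorAlgebra K V ⊗[K] TensorAlgebra K V,
        snoc K V (LinearMap.lTensor _ (letter K V)
          (LinearMap.rTensor _ (LinearMap.mulLeft K (TensorAlgebra.ι K y)) Z)) =
        TensorAlgebra.ι K y * snoc K V (LinearMap.lTensor _ (letter K V) Z) := by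
      intro Z
      induction Z with
      | zero => simp
      | add a b ha hb => simp only [map_add, ha, hb, mul_add]
      | tmul a b => simp [mul_assoc]
    rw [comul_cons, map_add, map_add, h]
    conv_lhs => rw [hw]
    simp [counit_cons, letter_cons, mul_add]

/-- First-letter version, suited to `δ`, whose recursion runs over the first block. -/
theorem eq_counit_add_cons (w : TensorAlgebra K V) :
    w = counit K V w • 1 + LinearMap.mul' K _
      (LinearMap.rTensor _ (TensorAlgebra.ι K ∘ₗ letter K V) (comul K V w)) := by
  induction w using word_induction with
  | h1 => simp [counit_one, comul_one, letter_one]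
  | hadd u w hu hw =>
    conv_lhs => rw [hu, hw]
    simp only [map_add, add_smul]; abel
  | hsmul c w hw =>
    conv_lhs => rw [hw]
    simp only [map_smul, smul_add, smul_smul, smul_eq_mul]
  | hcons y w hw =>
    have h : (TensorAlgebra.ι K ∘ₗ letter K V) ∘ₗ LinearMap.mulLeft K (TensorAlgebra.ι K y) =
        LinearMap.toSpanSingleton K _ (TensorAlgebra.ι K y) ∘ₗ counit K V := by
      ext u; simp [letter_cons]
    rw [comul_cons, map_add, ← LinearMap.comp_apply (LinearMap.rTensor _ _)
      (LinearMap.rTensor _ _), ← LinearMap.rTensor_comp, h,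
      LinearMap.rTensor_comp_apply _ _ (counit K V), counit_comul_left]
    simp [counit_cons, letter_one]

end Words

/-! ### The counit `ε_δ` on words -/

section CounitDelta

variable [NonUnitalCommRing V] [Module K V] [Coalgebra K V]

theorem counitδ_one : counitδ K V 1 = 1 := wordRec_one _ _

theorem counitδ_cons (y : V) (w : TensorAlgebra K V) :
    counitδ K V (TensorAlgebra.ι K y * w) = Coalgebra.counit (R := K) y * counit K V w :=
  wordRec_cons _ _ _ _

/-- So `ε_δ` is the counit of `uV` composed with `w ↦ ε(w) + letter w`; its multiplicativity and its
value on the lifts follow from this. -/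
theorem counitδ_eq (w : TensorAlgebra K V) :
    counitδ K V w = counit K V w + Coalgebra.counit (R := K) (letter K V w) := by
  induction w using word_induction with
  | h1 => simp [counitδ_one, counit_one, letter_one]
  | hadd u w hu hw => simp only [map_add, hu, hw]; ring
  | hsmul c w hw => simp only [map_smul, hw, smul_eq_mul]; ring
  | hcons y w _ => simp [counitδ_cons, counit_cons, letter_cons, mul_comm]

end CounitDelta

/-! ### The quasishuffle product against `Δ`, the letter part and the counits -/

variable [NonUnitalCommRing V] [Module K V] [SMulCommClass K V V] [IsScalarTower K V V]

theorem counit_qmul (u v : TensorAlgebra K V) :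
    counit K V (qmul K V u v) = counit K V u * counit K V v := by
  induction u using word_induction with
  | h1 => simp [one_qmul, counit_one]
  | hadd u w hu hw => simp only [map_add, LinearMap.add_apply, hu, hw, add_mul]
  | hsmul c w hw => simp only [map_smul, LinearMap.smul_apply, hw, smul_eq_mul, mul_assoc]
  | hcons x u hu =>
    clear hu
    rw [counit_cons, zero_mul]
    induction v using word_induction with
    | h1 => rw [qmul_one, counit_cons]
    | hadd v w hv hw => rw [map_add, map_add, hv, hw, add_zero]
    | hsmul c w hw => rw [map_smul, map_smul, hw, smul_zero]
    | hcons y v hv => simp [cons_qmul_cons, counit_cons]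

/-- The deconcatenation is multiplicative for the quasishuffle product. -/
theorem comul_qmul (u v : TensorAlgebra K V) :
    comul K V (qmul K V u v) =
      TensorProduct.map₂ (qmul K V) (qmul K V) (comul K V u) (comul K V v) := by
  have hone : ∀ Z, TensorProduct.map₂ (qmul K V) (qmul K V) (1 ⊗ₜ 1) Z = Z := by
    intro Z
    induction Z with
    | zero => simp
    | add a b ha hb => simp only [map_add, ha, hb]
    | tmul a b => simp [one_qmul]
  have hone' : ∀ Z, TensorProduct.map₂ (qmul K V) (qmul K V) Z (1 ⊗ₜ 1) = Z := by
    intro Z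
    induction Z with
    | zero => simp
    | add a b ha hb => simp only [map_add, LinearMap.add_apply, ha, hb]
    | tmul a b => simp [qmul_one]
  induction u using word_induction generalizing v with
  | h1 => rw [one_qmul, comul_one, hone]
  | hadd u w hu hw => simp only [map_add, LinearMap.add_apply, hu, hw]
  | hsmul c w hw => simp only [map_smul, LinearMap.smul_apply, hw]
  | hcons x a ha =>
    induction v using word_induction with
    | h1 => rw [qmul_one, comul_one, hone']
    | hadd v w hv hw => simp only [map_add, hv, hw]
    | hsmul c w hw => simp only [map_smul, hw]
    | hcons y b hb =>
      -- The cuts of `x a` and `y b` are sorted according to whether their left factor is empty.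
      -- `h1` and `h2` treat one empty left factor, `h3` none, where the three-term product rule
      -- acts on the left factors.
      have h1 : ∀ Z u, TensorProduct.map₂ (qmul K V) (qmul K V) (1 ⊗ₜ u)
          (LinearMap.rTensor _ (LinearMap.mulLeft K (TensorAlgebra.ι K y)) Z) =
          LinearMap.rTensor _ (LinearMap.mulLeft K (TensorAlgebra.ι K y))
            (TensorProduct.map₂ (qmul K V) (qmul K V) (1 ⊗ₜ u) Z) := by
        intro Z u
        induction Z with
        | zero => simp
        | add a b ha hb => simp only [map_add, ha, hb]
        | tmul a b => simp [one_qmul]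
      have h2 : ∀ Z u, TensorProduct.map₂ (qmul K V) (qmul K V)
          (LinearMap.rTensor _ (LinearMap.mulLeft K (TensorAlgebra.ι K x)) Z) (1 ⊗ₜ u) =
          LinearMap.rTensor _ (LinearMap.mulLeft K (TensorAlgebra.ι K x))
            (TensorProduct.map₂ (qmul K V) (qmul K V) Z (1 ⊗ₜ u)) := by
        intro Z u
        induction Z with
        | zero => simp
        | add a b ha hb => simp only [map_add, LinearMap.add_apply, ha, hb]
        | tmul a b => simp [qmul_one]
      have h3 : ∀ Z Y, TensorProduct.map₂ (qmul K V) (qmul K V)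
          (LinearMap.rTensor _ (LinearMap.mulLeft K (TensorAlgebra.ι K x)) Z)
          (LinearMap.rTensor _ (LinearMap.mulLeft K (TensorAlgebra.ι K y)) Y) =
          LinearMap.rTensor _ (LinearMap.mulLeft K (TensorAlgebra.ι K x))
            (TensorProduct.map₂ (qmul K V) (qmul K V) Z
              (LinearMap.rTensor _ (LinearMap.mulLeft K (TensorAlgebra.ι K y)) Y)) +
          LinearMap.rTensor _ (LinearMap.mulLeft K (TensorAlgebra.ι K y))
            (TensorProduct.map₂ (qmul K V) (qmul K V)
              (LinearMap.rTensor _ (LinearMap.mulLeft K (TensorAlgebra.ι K x)) Z) Y) +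
          LinearMap.rTensor _ (LinearMap.mulLeft K (TensorAlgebra.ι K (x * y)))
            (TensorProduct.map₂ (qmul K V) (qmul K V) Z Y) := by
        intro Z Y
        induction Z with
        | zero => simp
        | add a b ha hb => simp only [map_add, LinearMap.add_apply, ha, hb]; abel
        | tmul a b =>
          induction Y with
          | zero => simp
          | add c d hc hd => simp only [map_add, hc, hd]; abel
          | tmul c d => simp [cons_qmul_cons, TensorProduct.add_tmul]
      have e : TensorProduct.map₂ (qmul K V) (qmul K V) (1 ⊗ₜ[K] (TensorAlgebra.ι K x * a))
          (1 ⊗ₜ[K] (TensorAlgebra.ι K y * b)) =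
          1 ⊗ₜ qmul K V (TensorAlgebra.ι K x * a) (TensorAlgebra.ι K y * b) := by
        simp [one_qmul]
      rw [cons_qmul_cons, map_add, map_add, comul_cons x (qmul K V _ _),
        comul_cons y (qmul K V _ _), comul_cons (x * y) (qmul K V _ _), ha, ha, hb]
      simp only [comul_cons x a, comul_cons y b, map_add, LinearMap.add_apply, h1, h2, h3, e]
      rw [cons_qmul_cons]
      simp only [TensorProduct.tmul_add]
      abel

/-- The map `w ↦ ε(w) + letter w` is multiplicative from words to `uV = K ⊕ V`. -/
theorem letter_qmul (u v : TensorAlgebra K V) :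
    letter K V (qmul K V u v) = counit K V u • letter K V v + counit K V v • letter K V u +
      letter K V u * letter K V v := by
  induction u using word_induction with
  | h1 => simp [one_qmul, counit_one, letter_one]
  | hadd u w hu hw =>
    simp only [map_add, LinearMap.add_apply, hu, hw, add_mul, add_smul, smul_add]; abel
  | hsmul c w hw =>
    simp only [map_smul, LinearMap.smul_apply, hw, smul_eq_mul, mul_smul, smul_add,
      smul_mul_assoc, smul_comm c]
  | hcons x u hu =>
    clear hu
    induction v using word_induction with
    | h1 => simp [qmul_one, letter_one, counit_one]
    | hadd v w hv hw =>
      simp only [map_add, hv, hw, mul_add, add_smul, smul_add]; abel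
    | hsmul c w hw =>
      simp only [map_smul, hw, smul_eq_mul, mul_smul, smul_add, mul_smul_comm, smul_comm c]
    | hcons y v hv =>
      simp [cons_qmul_cons, counit_cons, letter_cons, counit_qmul, mul_smul, smul_mul_assoc,
        mul_smul_comm, smul_comm (counit K V u)]

variable [Coalgebra K V]

theorem counitδ_qmul [NonunitalBialgebra K V] (u v : TensorAlgebra K V) :
    counitδ K V (qmul K V u v) = counitδ K V u * counitδ K V v := by
  simp only [counitδ_eq, counit_qmul, letter_qmul, map_add, map_smul, smul_eq_mul,
    NonunitalBialgebra.counit_mul]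
  ring

/-! ### The coaction of `uV` on words -/

theorem coaction_one : coaction K V 1 = 1 := map_one (TensorAlgebra.lift K _)

theorem coaction_mul (u w : TensorAlgebra K V) :
    coaction K V (u * w) = coaction K V u * coaction K V w := map_mul (TensorAlgebra.lift K _) u w

theorem coaction_ι (y : V) : coaction K V (TensorAlgebra.ι K y) =
    TensorProduct.map (TensorAlgebra.ι K) (Unitization.inrHom K K V)
      (Coalgebra.comul (R := K) y) :=
  TensorAlgebra.lift_ι_apply _ y

/-- The coaction preserves the length of words. -/
theorem rTensor_counit_coaction (w : TensorAlgebra K V) :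
    LinearMap.rTensor _ (counit K V) (coaction K V w) = counit K V w ⊗ₜ 1 := by
  induction w using word_induction with
  | h1 => simp [coaction_one, Algebra.TensorProduct.one_def]
  | hadd u w hu hw => simp only [map_add, hu, hw, TensorProduct.add_tmul]
  | hsmul c w hw => simp only [map_smul, hw, TensorProduct.smul_tmul']
  | hcons y w _ =>
    rw [coaction_mul, coaction_ι, counit_cons, TensorProduct.zero_tmul]
    generalize coaction K V w = Z
    generalize (Coalgebra.comul y : V ⊗[K] V) = X
    induction X with
    | zero => simp
    | add a b ha hb => simp only [map_add, add_mul, ha, hb, add_zero]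
    | tmul a b =>
      induction Z with
      | zero => simp
      | add c d hc hd => simp only [map_add, mul_add, hc, hd, add_zero]
      | tmul c d => simp [counit_cons]

/-- Applying `ε_δ` to the words of the coaction recovers the letter part. -/
theorem counitδ_coaction (w : TensorAlgebra K V) :
    TensorProduct.lid K V (TensorProduct.map (counitδ K V) (Unitization.sndHom K K V)
      (coaction K V w)) = letter K V w := by
  induction w using word_induction with
  | h1 => simp [coaction_one, Algebra.TensorProduct.one_def, letter_one]
  | hadd u w hu hw => simp only [map_add, hu, hw]
  | hsmul c w hw => simp only [map_smul, hw]
  | hcons y w _ =>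
    -- Since `ε_δ(a c) = ε_V(a) ε_Δ(c)`, the expression splits into a product in `uV`. The counit
    -- axiom of `V` evaluates one factor, `rTensor_counit_coaction` the other.
    have key : ∀ (X : V ⊗[K] V) (Z : TensorAlgebra K V ⊗[K] Unitization K V),
        TensorProduct.lid K V (TensorProduct.map (counitδ K V) (Unitization.sndHom K K V)
          (TensorProduct.map (TensorAlgebra.ι K) (Unitization.inrHom K K V) X * Z)) =
        Unitization.sndHom K K V ((TensorProduct.lid K _ (TensorProduct.map
          (Coalgebra.counit (R := K)) (Unitization.inrHom K K V) X)) *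
            TensorProduct.lid K _ (LinearMap.rTensor _ (counit K V) Z)) := by
      intro X Z
      induction X with
      | zero => simp
      | add a b ha hb => simp only [map_add, add_mul, ha, hb]
      | tmul a b =>
        induction Z with
        | zero => simp
        | add c d hc hd => simp only [map_add, mul_add, hc, hd]
        | tmul c d =>
          simp [counitδ_cons, smul_smul, mul_comm]
    have h : (TensorProduct.map (Coalgebra.counit (R := K)) (Unitization.inrHom K K V)
        (Coalgebra.comul (R := K) y)) = 1 ⊗ₜ (y : Unitization K V) := by
      have := congrArg (LinearMap.lTensor K (Unitization.inrHom K K V))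
        (Coalgebra.rTensor_counit_comul (R := K) y)
      rw [← LinearMap.comp_apply, LinearMap.lTensor_comp_rTensor] at this
      simpa using this
    rw [coaction_mul, coaction_ι, key, h, rTensor_counit_coaction, letter_cons]
    simp

end QSh

/-! ### Recursions along the coproduct of a connected bialgebra -/

section Connected

variable {K B W U : Type*} [Field K] [Ring B] [Bialgebra K B]
  [AddCommGroup W] [Module K W] [AddCommGroup U] [Module K U]

open Coalgebra (comul counit)

/-- Over a field the image of `f` has a complement. An inclusion of kernels thus becomes a
factorisation, which, unlike the inclusion, can be tensored directly. -/
theorem LinearMap.exists_comp_eq_of_ker_le {M N P : Type*} [AddCommGroup M] [Module K M]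
    [AddCommGroup N] [Module K N] [AddCommGroup P] [Module K P] (f : M →ₗ[K] N) (g : M →ₗ[K] P)
    (h : LinearMap.ker f ≤ LinearMap.ker g) : ∃ k : N →ₗ[K] P, k ∘ₗ f = g := by
  obtain ⟨l, hl⟩ := ((LinearMap.ker f).liftQ f le_rfl).exists_leftInverse_of_injective
    (Submodule.ker_liftQ_eq_bot _ _ _ le_rfl)
  refine ⟨(LinearMap.ker f).liftQ g h ∘ₗ l, ?_⟩
  ext x
  have := DFunLike.congr_fun hl ((LinearMap.ker f).mkQ x)
  simp only [LinearMap.comp_apply, Submodule.mkQ_apply, Submodule.liftQ_apply,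
    LinearMap.id_apply] at this ⊢
  rw [this, Submodule.liftQ_apply]

theorem comul_eq_add_reducedComul (x : B) :
    comul (R := K) x = x ⊗ₜ 1 + 1 ⊗ₜ x + reducedComul K B x := by
  simp [reducedComul]

theorem rTensor_counit_reducedComul (x : B) (hx : counit (R := K) x = 0) :
    LinearMap.rTensor B (counit (R := K) (A := B)) (reducedComul K B x) = 0 := by
  simp [reducedComul, hx]

/-- Induction on the filtration of a connected bialgebra. -/
theorem IsConnectedBialgebra.linearMap_eq_zero (hB : IsConnectedBialgebra K B) (D : B →ₗ[K] W)
    (h1 : D 1 = 0)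
    (h : ∀ x : B, counit (R := K) x = 0 → LinearMap.rTensor B D (reducedComul K B x) = 0 →
      D x = 0) : D = 0 := by
  -- Connectedness only concerns `ker ε`; `p` projects onto it, and `D ∘ p = D` because `D 1 = 0`.
  set p : B →ₗ[K] B := LinearMap.id - Algebra.linearMap K B ∘ₗ counit with hp
  have hpx : ∀ x, p x = x - algebraMap K B (counit (R := K) x) := fun x => rfl
  have hεp : ∀ x, counit (R := K) (p x) = 0 := fun x => by simp [hpx]
  have hDp : D ∘ₗ p = D := by
    ext x
    simp [hpx, Algebra.algebraMap_eq_smul_one, h1]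
  have key : ∀ n (x : B), counit (R := K) x = 0 → iterReducedComul K B n x = 0 → D x = 0 := by
    intro n
    induction n with
    | zero =>
      intro x _ hx
      rw [TensorAlgebra.ι_eq_zero_iff K x |>.1 hx, map_zero]
    | succ n ih =>
      intro x hε hx
      refine h x hε ?_
      -- By the induction hypothesis `D` factors on `ker ε` through the `n`-th iterate. It remains
      -- to see that this iterate kills the left factor of the reduced coproduct of `x`, which `p`
      -- leaves unchanged.
      obtain ⟨k, hk⟩ := LinearMap.exists_comp_eq_of_ker_le (iterReducedComul K B n ∘ₗ p)
        (D ∘ₗ p) (fun y hy => ih _ (hεp y) hy)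
      have hpR : LinearMap.rTensor B p (reducedComul K B x) = reducedComul K B x := by
        rw [hp, LinearMap.rTensor_sub, LinearMap.sub_apply, LinearMap.rTensor_comp_apply,
          rTensor_counit_reducedComul x hε]
        simp
      have hz : LinearMap.rTensor B (iterReducedComul K B n) (reducedComul K B x) = 0 := by
        apply QSh.snoc_injective
        rw [map_zero, ← hx]
        simp only [QSh.snoc, iterReducedComul, LinearMap.comp_apply]
        rw [← LinearMap.comp_apply (LinearMap.lTensor _ _), LinearMap.lTensor_comp_rTensor]
      rw [← hDp, ← hk, LinearMap.rTensor_comp_apply, LinearMap.rTensor_comp_apply, hpR, hz,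
        map_zero]
  rw [← hDp]
  ext x
  by_cases hx : counit (R := K) (p x) = 0
  · obtain ⟨n, hn⟩ := hB _ hx
    exact key n _ hx hn
  · exact absurd (hεp x) hx

/-- In `Δ(x)`, the term `x ⊗ 1` is killed by `g 1 = 0` and `1 ⊗ x` by `D 1 = 0`. Only the reduced
coproduct is left, and the induction on the filtration applies. -/
theorem IsConnectedBialgebra.eq_zero_of_eq_right (hB : IsConnectedBialgebra K B)
    (β : W ⊗[K] U →ₗ[K] W) (g : B →ₗ[K] U) (hg : g 1 = 0) (D : B →ₗ[K] W)
    (h : ∀ x, D x = β (TensorProduct.map D g (comul (R := K) x))) : D = 0 := by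
  have h1 : D 1 = 0 := by
    rw [h, Bialgebra.comul_one, Algebra.TensorProduct.one_def]; simp [hg]
  refine hB.linearMap_eq_zero D h1 fun x _ hx => ?_
  rw [h, comul_eq_add_reducedComul, map_add, ← LinearMap.lTensor_comp_rTensor,
    LinearMap.comp_apply _ _ (reducedComul K B x), hx]
  simp [hg, h1]

/-- Two maps satisfying the same recursion on the left factor of the coproduct are equal. -/
theorem IsConnectedBialgebra.eq_of_eq_right (hB : IsConnectedBialgebra K B)
    (h : B →ₗ[K] W) (β : W ⊗[K] U →ₗ[K] W) (g : B →ₗ[K] U) (hg : g 1 = 0) {Φ Ψ : B →ₗ[K] W}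
    (hΦ : ∀ x, Φ x = h x + β (TensorProduct.map Φ g (comul (R := K) x)))
    (hΨ : ∀ x, Ψ x = h x + β (TensorProduct.map Ψ g (comul (R := K) x))) : Φ = Ψ := by
  refine sub_eq_zero.1 (hB.eq_zero_of_eq_right β g hg (Φ - Ψ) fun x => ?_)
  have e : TensorProduct.map (Φ - Ψ) g = TensorProduct.map Φ g - TensorProduct.map Ψ g := by
    ext; simp [TensorProduct.sub_tmul]
  rw [LinearMap.sub_apply, hΦ, hΨ, e]
  simp

/-- The one-variable case gives `D 1 = 0` and `D · 1 = 0`. Then the induction is run in `x` and,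
inside it, in `y`: the terms not covered by an induction hypothesis contain `D 1`, `D x 1` or `g 1
1`. -/
theorem IsConnectedBialgebra.eq_zero_of_eq_right₂ (hB : IsConnectedBialgebra K B)
    (β : W ⊗[K] U →ₗ[K] W) (g : B →ₗ[K] B →ₗ[K] U) (hg : g 1 1 = 0) (D : B →ₗ[K] B →ₗ[K] W)
    (h : ∀ x y, D x y = β (TensorProduct.map₂ D g (comul (R := K) x) (comul (R := K) y))) :
    D = 0 := by
  have hmap : ∀ (D : B →ₗ[K] B →ₗ[K] W) (a b : B) (Z : B ⊗[K] B),
      TensorProduct.map₂ D g (a ⊗ₜ b) Z = TensorProduct.map (D a) (g b) Z := by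
    intro D a b Z
    induction Z with
    | zero => simp
    | add u v hu hv => simp only [map_add, hu, hv]
    | tmul u v => simp
  have hmap' : ∀ (a b : B) (Z : B ⊗[K] B),
      TensorProduct.map₂ D g Z (a ⊗ₜ b) = TensorProduct.map (D.flip a) (g.flip b) Z := by
    intro a b Z
    induction Z with
    | zero => simp
    | add u v hu hv => simp only [map_add, LinearMap.add_apply, hu, hv]
    | tmul u v => simp
  have hfac : ∀ Z Y, LinearMap.rTensor B D Z = 0 → TensorProduct.map₂ D g Z Y = 0 := by
    intro Z Y hZ
    have : TensorProduct.map₂ D g Z = TensorProduct.map₂ LinearMap.id g (LinearMap.rTensor B D Z) := by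
      clear hZ
      induction Z with
      | zero => simp
      | add u v hu hv => simp only [map_add, hu, hv]
      | tmul u v => ext; simp
    rw [this, hZ]; simp
  have hl : D 1 = 0 := hB.eq_zero_of_eq_right β (g 1) hg (D 1) fun y => by
    rw [h, Bialgebra.comul_one, Algebra.TensorProduct.one_def, hmap]
  have hr : D.flip 1 = 0 := hB.eq_zero_of_eq_right β (g.flip 1) hg (D.flip 1) fun y => by
    rw [LinearMap.flip_apply, h, Bialgebra.comul_one, Algebra.TensorProduct.one_def, hmap']
  refine hB.linearMap_eq_zero D hl fun x _ hx => ?_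
  refine hB.linearMap_eq_zero (D x) (DFunLike.congr_fun hr x) fun y _ hy => ?_
  have e : TensorProduct.map (D x) (g 1) (reducedComul K B y) = 0 := by
    rw [← LinearMap.lTensor_comp_rTensor, LinearMap.comp_apply, hy, map_zero]
  have e1 : D x 1 = 0 := DFunLike.congr_fun hr x
  rw [h, comul_eq_add_reducedComul x, map_add, map_add, LinearMap.add_apply, LinearMap.add_apply,
    hfac _ _ hx, hmap, hmap, hl, comul_eq_add_reducedComul y,
    map_add (TensorProduct.map (D x) (g 1)), e]
  simp [hg, e1]

/-- Two bilinear maps satisfying the same recursion on the left factors of the coproducts are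
equal. -/
theorem IsConnectedBialgebra.eq_of_eq_right₂ (hB : IsConnectedBialgebra K B)
    (h : B →ₗ[K] B →ₗ[K] W) (β : W ⊗[K] U →ₗ[K] W) (g : B →ₗ[K] B →ₗ[K] U) (hg : g 1 1 = 0)
    {Φ Ψ : B →ₗ[K] B →ₗ[K] W}
    (hΦ : ∀ x y, Φ x y =
      h x y + β (TensorProduct.map₂ Φ g (comul (R := K) x) (comul (R := K) y)))
    (hΨ : ∀ x y, Ψ x y =
      h x y + β (TensorProduct.map₂ Ψ g (comul (R := K) x) (comul (R := K) y))) : Φ = Ψ := by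
  refine sub_eq_zero.1 (hB.eq_zero_of_eq_right₂ β g hg (Φ - Ψ) fun x y => ?_)
  have : ∀ Z Y : B ⊗[K] B, TensorProduct.map₂ (Φ - Ψ) g Z Y =
      TensorProduct.map₂ Φ g Z Y - TensorProduct.map₂ Ψ g Z Y := by
    intro Z Y
    induction Z with
    | zero => simp
    | add a b ha hb => simp only [map_add, LinearMap.add_apply, ha, hb]; abel
    | tmul a b =>
      induction Y with
      | zero => simp
      | add c d hc hd => simp only [map_add, hc, hd]; abel
      | tmul c d => simp [TensorProduct.sub_tmul]
  rw [LinearMap.sub_apply, LinearMap.sub_apply, hΦ, hΨ, this, map_sub]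
  abel

/-- A recursion on the left factor of the coproduct has a solution. -/
theorem IsConnectedBialgebra.exists_eq_right (hB : IsConnectedBialgebra K B)
    (h : B →ₗ[K] W) (β : W ⊗[K] U →ₗ[K] W) (g : B →ₗ[K] U) (hg : g 1 = 0) :
    ∃ Φ : B →ₗ[K] W, ∀ x, Φ x = h x + β (TensorProduct.map Φ g (comul (R := K) x)) := by
  -- The solution is the Neumann series `∑ a n`, where `a n` is the `n`-th iterate of `Φ ↦ β ∘ (Φ ⊗
  -- g) ∘ Δ` at `h`.
  let a : ℕ → B →ₗ[K] W := fun n =>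
    Nat.rec h (fun _ a => β ∘ₗ TensorProduct.map a g ∘ₗ comul) n
  have ha : ∀ n x, a (n + 1) x = β (TensorProduct.map (a n) g (comul (R := K) x)) :=
    fun n x => rfl
  have ha1 : ∀ n, a (n + 1) 1 = 0 := by
    intro n
    rw [ha, Bialgebra.comul_one, Algebra.TensorProduct.one_def]; simp [hg]
  -- Elements on which the series is finite. The induction, applied to the quotient map by `S`,
  -- shows that these are all of `B`.
  let S : Submodule K B :=
    { carrier := {x | ∃ N, ∀ n ≥ N, a n x = 0}
      zero_mem' := ⟨0, by simp⟩
      add_mem' := by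
        rintro x y ⟨N, hN⟩ ⟨M, hM⟩
        exact ⟨max N M, fun n hn => by
          rw [map_add, hN n (le_of_max_le_left hn), hM n (le_of_max_le_right hn), add_zero]⟩
      smul_mem' := by
        rintro c x ⟨N, hN⟩
        exact ⟨N, fun n hn => by rw [map_smul, hN n hn, smul_zero]⟩ }
  have hS : S.mkQ = 0 := by
    refine hB.linearMap_eq_zero S.mkQ ?_ fun x _ hx => ?_
    · rw [Submodule.mkQ_apply, Submodule.Quotient.mk_eq_zero]
      refine ⟨1, fun n hn => ?_⟩
      obtain ⟨m, rfl⟩ := Nat.exists_eq_add_of_le' hn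
      exact ha1 m
    · rw [Submodule.mkQ_apply, Submodule.Quotient.mk_eq_zero]
      -- Right exactness of the tensor product places the reduced coproduct of `x` in the image of
      -- `S ⊗ B`.
      obtain ⟨z, hz⟩ := (rTensor_exact B (LinearMap.exact_subtype_mkQ S)
        S.mkQ_surjective (reducedComul K B x)).1 hx
      have : ∃ N, ∀ n ≥ N, TensorProduct.map (a n) g (LinearMap.rTensor B S.subtype z) = 0 := by
        clear hz
        induction z with
        | zero => exact ⟨0, by simp⟩
        | add u v hu hv =>
          obtain ⟨N, hN⟩ := hu
          obtain ⟨M, hM⟩ := hv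
          exact ⟨max N M, fun n hn => by
            rw [map_add, map_add, hN n (le_of_max_le_left hn), hM n (le_of_max_le_right hn),
              add_zero]⟩
        | tmul s b =>
          obtain ⟨N, hN⟩ := s.2
          exact ⟨N, fun n hn => by simp [hN n hn]⟩
      obtain ⟨N, hN⟩ := this
      -- One unit pays for unfolding the recursion; the second makes the remaining index positive,
      -- as `a 0 = h` need not vanish at `1`.
      refine ⟨N + 2, fun n hn => ?_⟩
      obtain ⟨m, rfl⟩ := Nat.exists_eq_add_of_le' (show 2 ≤ n by omega)
      rw [ha (m + 1), comul_eq_add_reducedComul, ← hz, map_add, hN (m + 1) (by omega)]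
      simp [hg, ha1]
  have hfin : ∀ x, ∃ N, ∀ n ≥ N, a n x = 0 := by
    intro x
    have := DFunLike.congr_fun hS x
    rwa [Submodule.mkQ_apply, LinearMap.zero_apply, Submodule.Quotient.mk_eq_zero] at this
  have hsupp : ∀ x, (Function.support fun n => a n x).Finite := by
    intro x
    obtain ⟨N, hN⟩ := hfin x
    refine (Set.finite_lt_nat N).subset fun n hn => ?_
    by_contra hlt
    exact hn (hN n (not_lt.1 hlt))
  let Φ : B →ₗ[K] W :=
    { toFun := fun x => ∑ᶠ n, a n x
      map_add' := by
        intro x y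
        simp only [map_add]
        exact finsum_add_distrib (hsupp x) (hsupp y)
      map_smul' := by
        intro c x
        simp only [map_smul, RingHom.id_apply]
        exact (smul_finsum' c (hsupp x)).symm }
  have hΦ : ∀ x, ∃ N, ∀ M ≥ N, Φ x = ∑ n ∈ Finset.range M, a n x := by
    intro x
    obtain ⟨N, hN⟩ := hfin x
    refine ⟨N, fun M hM => finsum_eq_finsetSum_of_support_subset _ fun n hn => ?_⟩
    simp only [Finset.coe_range, Set.mem_Iio]
    by_contra hlt
    exact hn (hN n (hM.le.trans (not_lt.1 hlt)))
  have hΦ2 : ∀ Z : B ⊗[K] B, ∃ N, ∀ M ≥ N,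
      TensorProduct.map Φ g Z = ∑ n ∈ Finset.range M, TensorProduct.map (a n) g Z := by
    intro Z
    induction Z with
    | zero => exact ⟨0, by simp⟩
    | add u v hu hv =>
      obtain ⟨N, hN⟩ := hu
      obtain ⟨M, hM⟩ := hv
      exact ⟨max N M, fun n hn => by
        simp only [map_add]
        rw [hN n (le_of_max_le_left hn), hM n (le_of_max_le_right hn), Finset.sum_add_distrib]⟩
    | tmul s b =>
      obtain ⟨N, hN⟩ := hΦ s
      exact ⟨N, fun n hn => by simp [hN n hn, TensorProduct.sum_tmul]⟩
  refine ⟨Φ, fun x => ?_⟩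
  obtain ⟨N, hN⟩ := hΦ x
  obtain ⟨M, hM⟩ := hΦ2 (comul (R := K) x)
  rw [hN (max N M + 1) (by omega), hM (max N M) (by omega), Finset.sum_range_succ', map_sum,
    add_comm]
  rfl

/-- Two maps satisfying the same recursion on the right factor of the coproduct are equal. -/
theorem IsConnectedBialgebra.eq_of_eq_left (hB : IsConnectedBialgebra K B)
    (h : B →ₗ[K] W) (β : U ⊗[K] W →ₗ[K] W) (g : B →ₗ[K] U) (hg : g 1 = 0) {Φ Ψ : B →ₗ[K] W}
    (hΦ : ∀ x, Φ x = h x + β (TensorProduct.map g Φ (comul (R := K) x)))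
    (hΨ : ∀ x, Ψ x = h x + β (TensorProduct.map g Ψ (comul (R := K) x))) : Φ = Ψ := by
  -- Connectedness is expressed on the left factors of `Δ`, while `D` now occurs on the right. The
  -- equation `D = g * D` is therefore solved by inverting `1 - g` under convolution, using the
  -- recursion on the left.
  set D := Φ - Ψ with hD
  have hDx : ∀ x, D x = β (TensorProduct.map g D (comul (R := K) x)) := by
    intro x
    have e : TensorProduct.map g (Φ - Ψ) = TensorProduct.map g Φ - TensorProduct.map g Ψ := by
      ext; simp [TensorProduct.tmul_sub]
    rw [hD, LinearMap.sub_apply, hΦ, hΨ, e]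
    simp
  -- the inverse of `1 - g` for the convolution product of maps from `B` to `End W`
  let g' : B →ₗ[K] Module.End K W := TensorProduct.curry β ∘ₗ g
  obtain ⟨I, hI⟩ := hB.exists_eq_right
    (Algebra.linearMap K (Module.End K W) ∘ₗ counit (R := K) (A := B))
    (LinearMap.mul' K (Module.End K W)) g' (by simp [g', hg])
  let ev : Module.End K W ⊗[K] W →ₗ[K] W := TensorProduct.lift LinearMap.id
  have h1 : ∀ x, D x = ev (LinearMap.lTensor _ D (LinearMap.rTensor _ g' (comul (R := K) x))) := by
    intro x
    rw [hDx]
    generalize comul (R := K) x = Z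
    induction Z with
    | zero => simp
    | add a b ha hb => simp only [map_add, ha, hb]
    | tmul a b => simp [ev, g']
  -- With `I = ε + I * g'` and `D = g' * D`, coassociativity gives `I * D = D + I * (g' * D) = D + I
  -- * D`, so `D = 0`.
  have h2 : ∀ x, ev (TensorProduct.map I D (comul (R := K) x)) =
      D x + ev (TensorProduct.map I D (comul (R := K) x)) := by
    intro x
    have e1 : ∀ Z : B ⊗[K] B, ev (TensorProduct.map I D Z) =
        D (TensorProduct.lid K B (LinearMap.rTensor _ (counit (R := K) (A := B)) Z)) +
        ev (LinearMap.lTensor _ ev (TensorProduct.map I (TensorProduct.map g' D)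
          (TensorProduct.assoc K B B B (LinearMap.rTensor _ (comul (R := K)) Z)))) := by
      intro Z
      induction Z with
      | zero => simp
      | add a b ha hb =>
        simp only [map_add]; rw [ha, hb]; abel
      | tmul a b =>
        rw [TensorProduct.map_tmul, hI]
        simp only [LinearMap.rTensor_tmul, TensorProduct.lid_tmul, map_smul,
          TensorProduct.add_tmul, map_add]
        congr 1
        · rw [show ∀ (f : Module.End K W) w, ev (f ⊗ₜ w) = f w from fun _ _ => rfl]
          generalize comul (R := K) a = Y
          induction Y with
          | zero => simp
          | add c d hc hd =>
            simp only [map_add, TensorProduct.add_tmul, LinearMap.add_apply, hc, hd]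
          | tmul c d => simp [ev]
    have e2 : ∀ Z : B ⊗[K] B,
        ev (LinearMap.lTensor _ ev (TensorProduct.map I (TensorProduct.map g' D)
          (LinearMap.lTensor _ (comul (R := K)) Z))) = ev (TensorProduct.map I D Z) := by
      intro Z
      induction Z with
      | zero => simp
      | add a b ha hb => simp only [map_add, ha, hb]
      | tmul a b =>
        simp only [LinearMap.lTensor_tmul, TensorProduct.map_tmul]
        rw [h1 b, ← LinearMap.comp_apply (LinearMap.lTensor _ _), LinearMap.lTensor_comp_rTensor]
    conv_lhs => rw [e1]
    rw [Coalgebra.coassoc_apply, e2, Coalgebra.rTensor_counit_comul]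
    simp
  refine sub_eq_zero.1 (LinearMap.ext fun x => ?_)
  exact left_eq_add.1 ((h2 x).trans (add_comm _ _))

end Connected

theorem TensorProduct.rTensor_lid_map {K L M N P : Type*} [CommRing K]
    [AddCommGroup L] [Module K L] [AddCommGroup M] [Module K M] [AddCommGroup N] [Module K N]
    [AddCommGroup P] [Module K P] (f : L →ₗ[K] K) (g : M →ₗ[K] N) (Z : (L ⊗[K] M) ⊗[K] P) :
    LinearMap.rTensor P ((TensorProduct.lid K N).toLinearMap ∘ₗ TensorProduct.map f g) Z =
      TensorProduct.lid K _ (TensorProduct.map f (LinearMap.rTensor P g)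
        (TensorProduct.assoc K L M P Z)) := by
  induction Z with
  | zero => simp
  | add a b ha hb => simp only [map_add, ha, hb]
  | tmul a b =>
    induction a with
    | zero => simp
    | add c d hc hd => simp only [TensorProduct.add_tmul, map_add, hc, hd]
    | tmul c d => simp [TensorProduct.smul_tmul']

/-! ### The coproduct of `uV` -/

section UnitaryExtension

variable {K V : Type*} [Field K] [NonUnitalCommRing V] [Module K V] [IsScalarTower K V V]
  [SMulCommClass K V V] [Coalgebra K V] [NonunitalBialgebra K V]

theorem rTensor_snd_uComul (z : Unitization K V) :
    LinearMap.rTensor _ (Unitization.sndHom K K V) (uComul K V z) =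
      LinearMap.lTensor V (Unitization.inrHom K K V) (Coalgebra.comul (R := K) z.snd) := by
  have h : uComul K V z = z.fst • 1 + inrTensor K V (Coalgebra.comul (R := K) z.snd) := by
    rw [← Algebra.algebraMap_eq_smul_one]; rfl
  rw [h, map_add, map_smul, inrTensor]
  generalize (Coalgebra.comul z.snd : V ⊗[K] V) = X
  induction X with
  | zero => simp [Algebra.TensorProduct.one_def]
  | add a b ha hb =>
    simp only [Algebra.TensorProduct.one_def, LinearMap.rTensor_tmul, Unitization.sndHom_apply,
      Unitization.snd_one, TensorProduct.zero_tmul, smul_zero, zero_add, map_add] at ha hb ⊢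
    rw [ha, hb]
  | tmul a b => simp [Algebra.TensorProduct.one_def]

end UnitaryExtension

/-! ### The letter part attached to a character -/

section Universal

variable {K V B : Type*} [Field K] [NonUnitalCommRing V] [Module K V]
  [IsScalarTower K V V] [SMulCommClass K V V] [Ring B] [Bialgebra K B]

open Coalgebra (comul counit)

/-- `(χ ⊗ snd) ∘ ρ : B → V`. -/
def characterLetter (ρ : B →ₐ[K] B ⊗[K] Unitization K V) (χ : B →ₐ[K] K) : B →ₗ[K] V :=
  (TensorProduct.lid K V).toLinearMap ∘ₗ
    TensorProduct.map χ.toLinearMap (Unitization.sndHom K K V) ∘ₗ ρ.toLinearMap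

theorem characterLetter_apply (ρ : B →ₐ[K] B ⊗[K] Unitization K V) (χ : B →ₐ[K] K) (x : B) :
    characterLetter ρ χ x = TensorProduct.lid K V
      (TensorProduct.map χ.toLinearMap (Unitization.sndHom K K V) (ρ x)) := rfl

theorem characterLetter_one (ρ : B →ₐ[K] B ⊗[K] Unitization K V) (χ : B →ₐ[K] K) :
    characterLetter ρ χ 1 = 0 := by
  simp [characterLetter_apply, Algebra.TensorProduct.one_def]

/-- `(χ ⊗ Id) ∘ ρ : B → uV`. -/
def characterUnitization (ρ : B →ₐ[K] B ⊗[K] Unitization K V) (χ : B →ₐ[K] K) :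
    B →ₐ[K] Unitization K V :=
  (Algebra.TensorProduct.lid K (Unitization K V)).toAlgHom.comp
    ((Algebra.TensorProduct.map χ (AlgHom.id K (Unitization K V))).comp ρ)

theorem characterUnitization_apply (ρ : B →ₐ[K] B ⊗[K] Unitization K V) (χ : B →ₐ[K] K) (x : B) :
    characterUnitization ρ χ x = TensorProduct.lid K _
      (LinearMap.rTensor _ χ.toLinearMap (ρ x)) := rfl

theorem snd_characterUnitization (ρ : B →ₐ[K] B ⊗[K] Unitization K V) (χ : B →ₐ[K] K) (x : B) :
    (characterUnitization ρ χ x).snd = characterLetter ρ χ x := by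
  rw [characterUnitization_apply, characterLetter_apply]
  generalize ρ x = Z
  induction Z with
  | zero => simp
  | add a b ha hb => simp only [map_add, Unitization.snd_add, ha, hb]
  | tmul a b => simp

variable [Coalgebra K V] [NonunitalBialgebra K V] {ρ : B →ₐ[K] B ⊗[K] Unitization K V}

/-- The condition `ρ(ker ε_Δ) ⊆ B ⊗ V` makes the scalar component vanish on `ker ε_Δ`; on scalars it
is the identity. -/
theorem fst_characterUnitization (hρ : IsBialgebraOverNonunital ρ) (χ : B →ₐ[K] K) (x : B) :
    (characterUnitization ρ χ x).fst = counit (R := K) x := by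
  have h0 : ∀ y : B, counit (R := K) y = 0 → (characterUnitization ρ χ y).fst = 0 := by
    intro y hy
    obtain ⟨Z, hZ⟩ := hρ.ker_counit y hy
    rw [characterUnitization_apply, ← hZ]
    clear hZ
    induction Z with
    | zero => simp
    | add a b ha hb => simp only [map_add, Unitization.fst_add, ha, hb, add_zero]
    | tmul a b => simp
  have := h0 (x - algebraMap K B (counit (R := K) x)) (by simp)
  change Unitization.fstHom K V _ = 0 at this
  rw [map_sub, AlgHom.commutes, map_sub, AlgHom.commutes, sub_eq_zero] at this
  exact this

/-- This is the `V`-component of the multiplicativity of `(χ ⊗ Id) ∘ ρ : B → uV`, and it matches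
`QSh.letter_qmul`. -/
theorem characterLetter_mul (hρ : IsBialgebraOverNonunital ρ) (χ : B →ₐ[K] K) (x y : B) :
    characterLetter ρ χ (x * y) = counit (R := K) x • characterLetter ρ χ y +
      counit (R := K) y • characterLetter ρ χ x +
      characterLetter ρ χ x * characterLetter ρ χ y := by
  simp only [← snd_characterUnitization, ← fst_characterUnitization hρ χ, map_mul,
    Unitization.snd_mul]

/-- The counit of `uV` applied to `(χ ⊗ Id) ∘ ρ` gives back `χ`, by the counit axiom of `ρ`. -/
theorem counit_characterLetter (hρ : IsBialgebraOverNonunital ρ) (χ : B →ₐ[K] K) (x : B) :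
    counit (R := K) x + counit (R := K) (characterLetter ρ χ x) = χ x := by
  have h : ∀ z : Unitization K V, uCounit K V z = z.fst + counit (R := K) z.snd := fun z => rfl
  rw [← snd_characterUnitization, ← fst_characterUnitization hρ χ, ← h,
    characterUnitization_apply]
  conv_rhs => rw [← hρ.toOver.counit x]
  generalize ρ x = Z
  induction Z with
  | zero => simp
  | add a b ha hb => simp only [map_add, ha, hb]
  | tmul a b => simp [mul_comm]

/-- Coassociativity of `ρ`, contracted by `χ`: the letter part intertwines `ρ` with `δ_V`. -/
theorem rTensor_characterLetter (hρ : IsBialgebraOverNonunital ρ) (χ : B →ₐ[K] K) (x : B) :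
    LinearMap.rTensor _ (characterLetter ρ χ) (ρ x) =
      LinearMap.lTensor V (Unitization.inrHom K K V) (comul (R := K) (characterLetter ρ χ x)) := by
  have h2 : ∀ Z : B ⊗[K] Unitization K V,
      TensorProduct.lid K _ (TensorProduct.map χ.toLinearMap
        (LinearMap.rTensor _ (Unitization.sndHom K K V))
          (LinearMap.lTensor B (uComul K V).toLinearMap Z)) =
      LinearMap.lTensor V (Unitization.inrHom K K V) (comul (R := K)
        (TensorProduct.lid K V
          (TensorProduct.map χ.toLinearMap (Unitization.sndHom K K V) Z))) := by
    intro Z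
    induction Z with
    | zero => simp
    | add a b ha hb => simp only [map_add, ha, hb]
    | tmul a b => simp [rTensor_snd_uComul]
  rw [characterLetter_apply, ← h2, ← hρ.toOver.coassoc, ← TensorProduct.rTensor_lid_map, ← LinearMap.rTensor_comp_apply]
  rfl

end Universal

/-! ### Lifting a map `B → V` to words -/

section Universal

variable {K V B : Type*} [Field K] [Ring B] [Bialgebra K B]

namespace QSh

variable [AddCommGroup V] [Module K V]

/-- A map into words given by the universal recursion with letter part `f`. -/
structure IsWordLift (f : B →ₗ[K] V) (φ : B →ₗ[K] TensorAlgebra K V) : Prop where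
  letter_one : f 1 = 0
  eq : ∀ x, φ x = Coalgebra.counit (R := K) x • 1 + snoc K V (TensorProduct.map φ f (Coalgebra.comul (R := K) x))

namespace IsWordLift

variable {f : B →ₗ[K] V} {φ : B →ₗ[K] TensorAlgebra K V}

theorem map_one (h : IsWordLift f φ) : φ 1 = 1 := by
  rw [h.eq, Bialgebra.comul_one, Algebra.TensorProduct.one_def]
  simp [h.letter_one]

theorem map_counit (h : IsWordLift f φ) (x : B) : QSh.counit K V (φ x) = Coalgebra.counit (R := K) x := by
  rw [h.eq]
  generalize Coalgebra.comul (R := K) x = Z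
  induction Z with
  | zero => simp [counit_one]
  | add a b ha hb =>
    simp only [map_add, map_smul, counit_one, smul_eq_mul, mul_one, add_eq_left] at ha hb ⊢
    rw [ha, hb, add_zero]
  | tmul a b => simp [counit_one, counit_snoc]

/-- The letter part of `φ(x') f(x'')` is `ε(x') f(x'')`, since the prefix must be empty; the counit
axiom concludes. -/
theorem letter_map (h : IsWordLift f φ) (x : B) : letter K V (φ x) = f x := by
  have key : ∀ Z : B ⊗[K] B, letter K V (snoc K V (TensorProduct.map φ f Z)) =
      f (TensorProduct.lid K B (LinearMap.rTensor B (Coalgebra.counit (R := K) (A := B)) Z)) := by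
    intro Z
    induction Z with
    | zero => simp
    | add a b ha hb => simp only [map_add, ha, hb]
    | tmul a b => simp [letter_snoc, h.map_counit]
  rw [h.eq, map_add, key, Coalgebra.rTensor_counit_comul]
  simp [QSh.letter_one]

/-- Both sides solve the recursion with source `φ(x) ⊗ 1` in which `f` appends a letter to the right
tensor factor; for `(φ ⊗ φ) ∘ Δ` this uses coassociativity. -/
theorem map_comul (h : IsWordLift f φ) (hB : IsConnectedBialgebra K B) (x : B) :
    QSh.comul K V (φ x) = TensorProduct.map φ φ (Coalgebra.comul (R := K) x) := by
  let β : (TensorAlgebra K V ⊗[K] TensorAlgebra K V) ⊗[K] V →ₗ[K]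
      TensorAlgebra K V ⊗[K] TensorAlgebra K V :=
    LinearMap.lTensor _ (snoc K V) ∘ₗ (TensorProduct.assoc K _ _ V).toLinearMap
  have hcomul : ∀ z, QSh.comul K V (snoc K V z) =
      snoc K V z ⊗ₜ 1 + β (LinearMap.rTensor V (QSh.comul K V) z) := by
    intro z
    induction z with
    | zero => simp
    | add a b ha hb => simp only [map_add, TensorProduct.add_tmul, ha, hb]; abel
    | tmul w y =>
      rw [snoc_tmul, comul_snoc, LinearMap.rTensor_tmul]
      congr 1
      generalize QSh.comul K V w = Z
      induction Z with
      | zero => simp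
      | add a b ha hb => simp only [map_add, TensorProduct.add_tmul, ha, hb]
      | tmul a b => simp [β]
  have e1 : ∀ Z : B ⊗[K] B, TensorProduct.map φ φ Z =
      φ (TensorProduct.rid K B (LinearMap.lTensor B (Coalgebra.counit (R := K) (A := B)) Z)) ⊗ₜ 1 +
      LinearMap.lTensor _ (snoc K V) (TensorProduct.map φ (TensorProduct.map φ f)
        (LinearMap.lTensor B (Coalgebra.comul (R := K)) Z)) := by
    intro Z
    induction Z with
    | zero => simp
    | add a b ha hb =>
      simp only [map_add, TensorProduct.add_tmul]; rw [ha, hb]; abel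
    | tmul a b =>
      rw [TensorProduct.map_tmul, h.eq b]
      simp [TensorProduct.tmul_add, TensorProduct.smul_tmul']
  have e2 : ∀ Z : B ⊗[K] B, LinearMap.lTensor _ (snoc K V)
      (TensorProduct.map φ (TensorProduct.map φ f)
        (TensorProduct.assoc K B B B (LinearMap.rTensor B (Coalgebra.comul (R := K)) Z))) =
      β (TensorProduct.map (TensorProduct.map φ φ ∘ₗ Coalgebra.comul) f Z) := by
    intro Z
    induction Z with
    | zero => simp
    | add a b ha hb => simp only [map_add, ha, hb]
    | tmul a b =>
      simp only [LinearMap.rTensor_tmul, TensorProduct.map_tmul, LinearMap.comp_apply]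
      generalize Coalgebra.comul (R := K) a = Y
      induction Y with
      | zero => simp
      | add c d hc hd => simp only [map_add, TensorProduct.add_tmul, hc, hd]
      | tmul c d => simp [β]
  refine DFunLike.congr_fun (hB.eq_of_eq_right
    ((TensorProduct.mk K (TensorAlgebra K V) (TensorAlgebra K V)).flip 1 ∘ₗ φ) β f h.letter_one
    (Φ := QSh.comul K V ∘ₗ φ) (Ψ := TensorProduct.map φ φ ∘ₗ Coalgebra.comul) (fun x => ?_)
    fun x => ?_) x
  · rw [LinearMap.comp_apply, LinearMap.comp_apply, LinearMap.flip_apply, TensorProduct.mk_apply]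
    conv_lhs => rw [h.eq]
    rw [map_add, hcomul, map_smul, comul_one, ← LinearMap.comp_apply (LinearMap.rTensor _ _),
      LinearMap.rTensor_comp_map]
    conv_rhs => rw [h.eq]
    rw [TensorProduct.add_tmul, TensorProduct.smul_tmul', add_assoc]
  · rw [LinearMap.comp_apply, e1, ← Coalgebra.coassoc_apply, e2, Coalgebra.lTensor_counit_comul]
    simp

end IsWordLift

end QSh

namespace QSh.IsWordLift

variable [NonUnitalCommRing V] [Module K V] [IsScalarTower K V V] [SMulCommClass K V V]
  {f : B →ₗ[K] V} {φ : B →ₗ[K] TensorAlgebra K V}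

/-- Both sides solve the two-variable recursion with last letter `f (x y)`: the left one since `Δ`
is multiplicative on `B`, the right one since it is so on words and `hf` matches `letter_qmul`. -/
theorem map_mul (h : IsWordLift f φ) (hB : IsConnectedBialgebra K B)
    (hf : ∀ x y, f (x * y) = Coalgebra.counit (R := K) x • f y + Coalgebra.counit (R := K) y • f x + f x * f y)
    (x y : B) : φ (x * y) = qmul K V (φ x) (φ y) := by
  have e1 : ∀ Z Y : B ⊗[K] B, TensorProduct.map φ f (Z * Y) =
      TensorProduct.map₂ ((LinearMap.mul K B).compr₂ φ) ((LinearMap.mul K B).compr₂ f) Z Y := by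
    intro Z Y
    induction Z with
    | zero => simp
    | add a b ha hb => simp only [add_mul, map_add, LinearMap.add_apply, ha, hb]
    | tmul a b =>
      induction Y with
      | zero => simp
      | add c d hc hd => simp only [mul_add, map_add, hc, hd]
      | tmul c d => simp
  have e2 : ∀ Z Y : B ⊗[K] B, LinearMap.lTensor _ (letter K V)
      (TensorProduct.map₂ (qmul K V) (qmul K V) (TensorProduct.map φ φ Z)
        (TensorProduct.map φ φ Y)) =
      TensorProduct.map₂ ((qmul K V).compl₁₂ φ φ) ((LinearMap.mul K B).compr₂ f) Z Y := by
    intro Z Y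
    induction Z with
    | zero => simp
    | add a b ha hb => simp only [map_add, LinearMap.add_apply, ha, hb]
    | tmul a b =>
      induction Y with
      | zero => simp
      | add c d hc hd => simp only [map_add, hc, hd]
      | tmul c d => simp [letter_qmul, h.letter_map, h.map_counit, hf]
  refine DFunLike.congr_fun (DFunLike.congr_fun (hB.eq_of_eq_right₂
    (((LinearMap.mul K K).compl₁₂ (Coalgebra.counit (R := K) (A := B))
      (Coalgebra.counit (R := K) (A := B))).compr₂ (LinearMap.toSpanSingleton K _ 1))
    (snoc K V) ((LinearMap.mul K B).compr₂ f) (by simp [h.letter_one])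
    (Φ := (LinearMap.mul K B).compr₂ φ) (Ψ := (qmul K V).compl₁₂ φ φ)
    (fun x y => ?_) fun x y => ?_) x) y
  · rw [LinearMap.compr₂_apply, LinearMap.mul_apply', h.eq, Bialgebra.comul_mul, e1]
    simp
  · rw [LinearMap.compl₁₂_apply, eq_counit_add_snoc (qmul K V _ _), comul_qmul, h.map_comul hB,
      h.map_comul hB, e2, counit_qmul, h.map_counit, h.map_counit]
    simp

/-- The coaction on words is multiplicative for concatenation, and `ρ` is compatible with `Δ` and
its counit. Thus both sides obey the same recursion as soon as `hf` settles the last letter. -/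
theorem map_coaction [Coalgebra K V] [NonunitalBialgebra K V]
    {ρ : B →ₐ[K] B ⊗[K] Unitization K V} (h : IsWordLift f φ)
    (hB : IsConnectedBialgebra K B) (hρ : IsBialgebraOverNonunital ρ)
    (hf : ∀ x, LinearMap.rTensor _ f (ρ x) =
      LinearMap.lTensor V (Unitization.inrHom K K V) (Coalgebra.comul (R := K) (f x)))
    (x : B) : coaction K V (φ x) = LinearMap.rTensor (Unitization K V) φ (ρ x) := by
  have e1 : ∀ Z : B ⊗[K] B, coaction K V (snoc K V (TensorProduct.map φ f Z)) =
      LinearMap.mul' K _ (TensorProduct.map (coaction K V ∘ₗ φ)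
        (coaction K V ∘ₗ TensorAlgebra.ι K ∘ₗ f) Z) := by
    intro Z
    induction Z with
    | zero => simp
    | add a b ha hb => simp only [map_add, ha, hb]
    | tmul a b => simp [coaction_mul]
  have e2 : ∀ Z : B ⊗[K] Unitization K V, LinearMap.rTensor (Unitization K V) φ Z =
      1 ⊗ₜ TensorProduct.lid K _ (LinearMap.rTensor _ (Coalgebra.counit (R := K) (A := B)) Z) +
      LinearMap.rTensor _ (snoc K V ∘ₗ TensorProduct.map φ f)
        (LinearMap.rTensor _ (Coalgebra.comul (R := K) (A := B)) Z) := by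
    intro Z
    induction Z with
    | zero => simp
    | add a b ha hb =>
      simp only [map_add, TensorProduct.tmul_add]; rw [ha, hb]; abel
    | tmul a b =>
      rw [LinearMap.rTensor_tmul, h.eq]
      simp [TensorProduct.add_tmul, TensorProduct.smul_tmul]
  have e3 : ∀ b, coaction K V (TensorAlgebra.ι K (f b)) =
      LinearMap.rTensor _ (TensorAlgebra.ι K ∘ₗ f) (ρ b) := by
    intro b
    rw [coaction_ι, LinearMap.rTensor_comp_apply, hf,
      ← LinearMap.comp_apply (LinearMap.rTensor _ _), LinearMap.rTensor_comp_lTensor]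
  have e4 : ∀ Y X : B ⊗[K] Unitization K V,
      LinearMap.rTensor _ (snoc K V ∘ₗ TensorProduct.map φ f) (mul1324 K B _ (Y ⊗ₜ X)) =
      LinearMap.rTensor _ φ Y * LinearMap.rTensor _ (TensorAlgebra.ι K ∘ₗ f) X := by
    intro Y X
    induction Y with
    | zero => simp
    | add a b ha hb => simp only [TensorProduct.add_tmul, map_add, add_mul, ha, hb]
    | tmul a b =>
      induction X with
      | zero => simp
      | add c d hc hd => simp only [TensorProduct.tmul_add, map_add, mul_add, hc, hd]
      | tmul c d => simp [mul1324]
  have e5 : ∀ Z : B ⊗[K] B, LinearMap.rTensor _ (snoc K V ∘ₗ TensorProduct.map φ f)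
      (mul1324 K B _ (TensorProduct.map ρ.toLinearMap ρ.toLinearMap Z)) =
      LinearMap.mul' K _ (TensorProduct.map (LinearMap.rTensor (Unitization K V) φ ∘ₗ
        ρ.toLinearMap) (coaction K V ∘ₗ TensorAlgebra.ι K ∘ₗ f) Z) := by
    intro Z
    induction Z with
    | zero => simp
    | add a b ha hb => simp only [map_add, ha, hb]
    | tmul a b =>
      rw [TensorProduct.map_tmul, e4, TensorProduct.map_tmul, LinearMap.mul'_apply,
        LinearMap.comp_apply (coaction K V), LinearMap.comp_apply (TensorAlgebra.ι K), e3]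
      rfl
  refine DFunLike.congr_fun (hB.eq_of_eq_right
    (LinearMap.toSpanSingleton K (TensorAlgebra K V ⊗[K] Unitization K V) 1 ∘ₗ
      Coalgebra.counit (R := K) (A := B))
    (LinearMap.mul' K _) (coaction K V ∘ₗ TensorAlgebra.ι K ∘ₗ f) (by simp [h.letter_one])
    (Φ := coaction K V ∘ₗ φ) (Ψ := LinearMap.rTensor (Unitization K V) φ ∘ₗ ρ.toLinearMap)
    (fun x => ?_) fun x => ?_) x
  · rw [← e1, LinearMap.comp_apply, h.eq, map_add, map_smul, coaction_one]
    rfl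
  · rw [← e5, LinearMap.comp_apply, AlgHom.toLinearMap_apply, e2, hρ.toOver.counit_comodule,
      hρ.toOver.comul_comodule]
    congr 1
    simp [Algebra.algebraMap_eq_smul_one, Algebra.TensorProduct.one_def]

end QSh.IsWordLift

end Universal

/-! ### Morphisms over `V` and their characters -/

theorem characterAct_apply {K B W : Type*} [Field K] [Ring B] [Bialgebra K B] [AddCommGroup W]
    [Module K W] (D : DoubleBialgebra K B) (φ : B →ₗ[K] W) (χ : B →ₐ[K] K) (x : B) :
    characterAct D φ χ x =
      TensorProduct.rid K _ (TensorProduct.map φ χ.toLinearMap (D.δ x)) := rfl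

theorem counitδ_characterAct {K V B : Type*} [Field K] [Ring B] [Bialgebra K B]
    [NonUnitalCommRing V] [Module K V] [Coalgebra K V] {D : DoubleBialgebra K B}
    {φ : B →ₗ[K] TensorAlgebra K V} (hδ : ∀ x, QSh.counitδ K V (φ x) = D.εδ x) (χ : B →ₐ[K] K)
    (x : B) :
    QSh.counitδ K V (characterAct D φ χ x) = χ x := by
  rw [characterAct_apply]
  conv_rhs => rw [← D.counit_left x]
  generalize D.δ x = Z
  induction Z with
  | zero => simp
  | add a b ha hb => simp only [map_add, ha, hb]
  | tmul a b => simp [hδ, mul_comm]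

section Universal

variable {K V B : Type*} [Field K] [Ring B] [Bialgebra K B] [NonUnitalCommRing V] [Module K V]
  [IsScalarTower K V V] [SMulCommClass K V V] [Coalgebra K V]

namespace IsBialgebraOverHom

variable {ρ : B →ₐ[K] B ⊗[K] Unitization K V} {φ ψ : B →ₗ[K] TensorAlgebra K V}

/-- On words the letter part is read off the coaction and `ε_δ`; `φ` carries this to `B`. -/
theorem letter_map (hφ : IsBialgebraOverHom ρ φ) {χ : B →ₐ[K] K}
    (hχ : ∀ x, QSh.counitδ K V (φ x) = χ x) (x : B) :
    QSh.letter K V (φ x) = characterLetter ρ χ x := by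
  rw [← QSh.counitδ_coaction, hφ.map_coaction, characterLetter_apply,
    ← LinearMap.comp_apply (TensorProduct.map _ _), LinearMap.map_comp_rTensor]
  congr 3
  exact LinearMap.ext hχ

theorem isWordLift (hφ : IsBialgebraOverHom ρ φ) {χ : B →ₐ[K] K}
    (hχ : ∀ x, QSh.counitδ K V (φ x) = χ x) :
    QSh.IsWordLift (characterLetter ρ χ) φ where
  letter_one := characterLetter_one ρ χ
  eq x := by
    conv_lhs => rw [QSh.eq_counit_add_snoc (φ x), hφ.map_counit, hφ.map_comul]
    rw [← LinearMap.comp_apply (LinearMap.lTensor _ _), LinearMap.lTensor_comp_map]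
    congr 4
    exact LinearMap.ext fun y => hφ.letter_map hχ y

/-- A morphism of bialgebras over `V` to `QSh(V)` is determined by its composition with `ε_δ`. -/
theorem eq_of_counitδ_eq (hB : IsConnectedBialgebra K B) (hφ : IsBialgebraOverHom ρ φ)
    (hψ : IsBialgebraOverHom ρ ψ) {χ : B →ₐ[K] K} (hφχ : ∀ x, QSh.counitδ K V (φ x) = χ x)
    (hψχ : ∀ x, QSh.counitδ K V (ψ x) = χ x) : φ = ψ :=
  hB.eq_of_eq_right
    (LinearMap.toSpanSingleton K _ 1 ∘ₗ Coalgebra.counit (R := K) (A := B)) (QSh.snoc K V)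
    (characterLetter ρ χ) (characterLetter_one ρ χ) (hφ.isWordLift hφχ).eq (hψ.isWordLift hψχ).eq

/-- The character `ε_δ ∘ φ`. -/
def character [NonunitalBialgebra K V] (hφ : IsBialgebraOverHom ρ φ) : B →ₐ[K] K :=
  AlgHom.ofLinearMap (QSh.counitδ K V ∘ₗ φ) (by simp [hφ.map_one, QSh.counitδ_one])
    (by intro x y; simp [hφ.map_mul, QSh.counitδ_qmul])

end IsBialgebraOverHom

theorem QSh.IsWordLift.isBialgebraOverHom [NonunitalBialgebra K V]
    {ρ : B →ₐ[K] B ⊗[K] Unitization K V} {φ : B →ₗ[K] TensorAlgebra K V} {χ : B →ₐ[K] K}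
    (h : QSh.IsWordLift (characterLetter ρ χ) φ) (hρ : IsBialgebraOverNonunital ρ)
    (hB : IsConnectedBialgebra K B) : IsBialgebraOverHom ρ φ where
  map_one := h.map_one
  map_mul := h.map_mul hB (characterLetter_mul hρ χ)
  map_counit := h.map_counit
  map_comul := h.map_comul hB
  map_coaction := h.map_coaction hB hρ (rTensor_characterLetter hρ χ)

theorem QSh.IsWordLift.counitδ_eq [NonunitalBialgebra K V]
    {ρ : B →ₐ[K] B ⊗[K] Unitization K V} {φ : B →ₗ[K] TensorAlgebra K V} {χ : B →ₐ[K] K}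
    (h : QSh.IsWordLift (characterLetter ρ χ) φ) (hρ : IsBialgebraOverNonunital ρ) (x : B) :
    QSh.counitδ K V (φ x) = χ x := by
  rw [QSh.counitδ_eq, h.map_counit, h.letter_map, counit_characterLetter hρ]

/-- For each character `χ`, there is a morphism `φ` of bialgebras over `V` from `B` to `QSh(V)`
with `ε_δ ∘ φ = χ`. -/
theorem exists_isBialgebraOverHom [NonunitalBialgebra K V]
    {ρ : B →ₐ[K] B ⊗[K] Unitization K V} (hρ : IsBialgebraOverNonunital ρ)
    (hB : IsConnectedBialgebra K B) (χ : B →ₐ[K] K) :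
    ∃ φ : B →ₗ[K] TensorAlgebra K V, IsBialgebraOverHom ρ φ ∧
      ∀ x, QSh.counitδ K V (φ x) = χ x := by
  obtain ⟨φ, hφ⟩ := hB.exists_eq_right
    (LinearMap.toSpanSingleton K _ 1 ∘ₗ Coalgebra.counit (R := K) (A := B)) (QSh.snoc K V)
    (characterLetter ρ χ) (characterLetter_one ρ χ)
  have h : QSh.IsWordLift (characterLetter ρ χ) φ := ⟨characterLetter_one ρ χ, hφ⟩
  exact ⟨φ, h.isBialgebraOverHom hρ hB, h.counitδ_eq hρ⟩

/-- If `V` is cocommutative, a block is given by the coaction. -/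
theorem QSh.block_eq_coaction [Coalgebra.IsCocomm K V] (w : TensorAlgebra K V) :
    QSh.block K V w = TensorProduct.comm K _ _
      (LinearMap.lTensor _ (Unitization.sndHom K K V) (QSh.coaction K V w)) := by
  have h : TensorAlgebra.lift K
      (TensorProduct.map (Unitization.inrHom K K V) (TensorAlgebra.ι K) ∘ₗ
        (Coalgebra.comul : V →ₗ[K] V ⊗[K] V)) =
      (Algebra.TensorProduct.comm K (TensorAlgebra K V) (Unitization K V)).toAlgHom.comp
        (TensorAlgebra.lift K
          (TensorProduct.map (TensorAlgebra.ι K) (Unitization.inrHom K K V) ∘ₗ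
            (Coalgebra.comul : V →ₗ[K] V ⊗[K] V))) := by
    apply TensorAlgebra.hom_ext
    ext v
    simp only [LinearMap.comp_apply, AlgHom.toLinearMap_apply, AlgHom.comp_apply,
      TensorAlgebra.lift_ι_apply]
    -- A block multiplies the letters `v'`, the coaction the letters `v''`; cocommutativity
    -- exchanges them.
    conv_lhs => rw [← Coalgebra.comm_comul K v]
    exact TensorProduct.map_comm _ _ _
  have h' : QSh.block K V w = LinearMap.rTensor _ (Unitization.sndHom K K V)
      (TensorProduct.comm K _ _ (QSh.coaction K V w)) :=
    congrArg (LinearMap.rTensor _ (Unitization.sndHom K K V)) (DFunLike.congr_fun h w)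
  rw [h', LinearMap.rTensor_comm]

theorem TensorProduct.map_lid_map_rightComm {A M N P : Type*} [AddCommGroup A] [Module K A]
    [AddCommGroup M] [Module K M] [AddCommGroup N] [Module K N] [AddCommGroup P] [Module K P]
    (f : A →ₗ[K] K) (g : M →ₗ[K] N) (φ : A →ₗ[K] P) (Z : (A ⊗[K] M) ⊗[K] A) :
    TensorProduct.map ((TensorProduct.lid K N).toLinearMap ∘ₗ TensorProduct.map f g) φ Z =
      TensorProduct.comm K _ _ (TensorProduct.map
        (φ ∘ₗ (TensorProduct.lid K A).toLinearMap ∘ₗ LinearMap.rTensor A f) g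
          (TensorProduct.rightComm K A M A Z)) := by
  induction Z with
  | zero => simp
  | add a b ha hb => simp only [map_add, ha, hb]
  | tmul a b =>
    induction a with
    | zero => simp
    | add c d hc hd => simp only [TensorProduct.add_tmul, map_add, hc, hd]
    | tmul c d => simp [TensorProduct.smul_tmul']

theorem TensorProduct.rid_map_rTensor_rightComm {A M P : Type*} [AddCommGroup A] [Module K A]
    [AddCommGroup M] [Module K M] [AddCommGroup P] [Module K P]
    (f : A →ₗ[K] K) (φ : A →ₗ[K] P) (Z : (A ⊗[K] M) ⊗[K] A) :
    TensorProduct.rid K _ (TensorProduct.map (LinearMap.rTensor M φ) f Z) =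
      LinearMap.rTensor M ((TensorProduct.rid K P).toLinearMap ∘ₗ TensorProduct.map φ f)
        (TensorProduct.rightComm K A M A Z) := by
  induction Z with
  | zero => simp
  | add a b ha hb => simp only [map_add, ha, hb]
  | tmul a b =>
    induction a with
    | zero => simp
    | add c d hc hd => simp only [TensorProduct.add_tmul, map_add, hc, hd]
    | tmul c d => simp [TensorProduct.smul_tmul']

/-! ### Compatibility with `δ`, and the action of characters -/

section DoubleBialgebra

variable [NonunitalBialgebra K V] {D : DoubleBialgebra K B}
  {ρ : B →ₐ[K] B ⊗[K] Unitization K V} {φ : B →ₗ[K] TensorAlgebra K V}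

/-- As `letter ∘ φ = (ε_δ ⊗ snd) ∘ ρ`, the right side involves `(ρ ⊗ Id) ∘ δ`. Exchanging it for `(δ
⊗ Id) ∘ ρ`, the left counit of `δ` collapses it to `(φ ⊗ snd) ∘ ρ` up to the flip, which is the
block. -/
theorem IsBialgebraOverHom.block_map [Coalgebra.IsCocomm K V] (hφ : IsBialgebraOverHom ρ φ)
    (hρ : IsDoubleBialgebraOver D ρ) (hδ : ∀ x, QSh.counitδ K V (φ x) = D.εδ x) (x : B) :
    QSh.block K V (φ x) = TensorProduct.map (QSh.letter K V ∘ₗ φ) φ (D.δ x) := by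
  have e : QSh.letter K V ∘ₗ φ = ((TensorProduct.lid K V).toLinearMap ∘ₗ
      TensorProduct.map D.εδ.toLinearMap (Unitization.sndHom K K V)) ∘ₗ ρ.toLinearMap :=
    LinearMap.ext (hφ.letter_map hδ)
  have e' : (φ ∘ₗ (TensorProduct.lid K B).toLinearMap ∘ₗ LinearMap.rTensor B D.εδ.toLinearMap) ∘ₗ
      D.δ.toLinearMap = φ := LinearMap.ext fun y => congrArg φ (D.counit_left y)
  rw [QSh.block_eq_coaction, hφ.map_coaction, e, ← LinearMap.map_comp_rTensor,
    LinearMap.comp_apply, TensorProduct.map_lid_map_rightComm, hρ.compat,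
    ← LinearMap.comp_apply (TensorProduct.map _ _) (LinearMap.rTensor _ _),
    LinearMap.map_comp_rTensor, e', ← LinearMap.comp_apply (LinearMap.lTensor _ _),
    LinearMap.lTensor_comp_rTensor]

/-- Both sides satisfy the first-block recursion `QSh.delta_eq` transported to `B`. The unknown sits
on the right factor of `Δ`, hence `eq_of_eq_left`. -/
theorem IsBialgebraOverHom.map_delta [Coalgebra.IsCocomm K V] (hφ : IsBialgebraOverHom ρ φ)
    (hρ : IsDoubleBialgebraOver D ρ) (hB : IsConnectedBialgebra K B)
    (hδ : ∀ x, QSh.counitδ K V (φ x) = D.εδ x) (x : B) :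
    QSh.delta K V (φ x) = TensorProduct.map φ φ (D.δ x) := by
  -- `Q` is `φ ⊗ φ` with the first letter of the left word split off; fed with `(Δ ⊗ Id) ∘ δ`, it
  -- can be rewritten by the comodule axiom for `Δ`.
  let Q : (B ⊗[K] B) ⊗[K] B →ₗ[K] TensorAlgebra K V ⊗[K] TensorAlgebra K V :=
    TensorProduct.map (LinearMap.mul' K _ ∘ₗ
      TensorProduct.map (TensorAlgebra.ι K ∘ₗ QSh.letter K V ∘ₗ φ) φ) φ
  have hrec : ∀ z, φ z = Coalgebra.counit (R := K) z • 1 + LinearMap.mul' K _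
      (TensorProduct.map (TensorAlgebra.ι K ∘ₗ QSh.letter K V ∘ₗ φ) φ
        (Coalgebra.comul (R := K) z)) := by
    intro z
    conv_lhs => rw [QSh.eq_counit_add_cons (φ z), hφ.map_counit, hφ.map_comul]
    rw [← LinearMap.comp_apply (LinearMap.rTensor _ _), LinearMap.rTensor_comp_map]
    rfl
  have e1 : ∀ Z : B ⊗[K] B, TensorProduct.map φ φ Z =
      1 ⊗ₜ φ (TensorProduct.lid K B (LinearMap.rTensor B (Coalgebra.counit (R := K) (A := B)) Z)) +
      Q (LinearMap.rTensor B (Coalgebra.comul (R := K)) Z) := by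
    intro Z
    induction Z with
    | zero => simp
    | add a b ha hb =>
      simp only [map_add, TensorProduct.tmul_add]; rw [ha, hb]; abel
    | tmul a b =>
      rw [TensorProduct.map_tmul, hrec a]
      simp [Q, TensorProduct.add_tmul, TensorProduct.smul_tmul]
  have e2 : ∀ Y X : B ⊗[K] B, Q (mul1324 K B B (Y ⊗ₜ X)) =
      QSh.closeBlock K V (TensorProduct.map (QSh.letter K V ∘ₗ φ) φ Y ⊗ₜ
        TensorProduct.map φ φ X) := by
    intro Y X
    induction Y with
    | zero => simp
    | add a b ha hb => simp only [TensorProduct.add_tmul, map_add, ha, hb]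
    | tmul a b =>
      induction X with
      | zero => simp
      | add c d hc hd => simp only [TensorProduct.tmul_add, map_add, hc, hd]
      | tmul c d => simp [mul1324, Q, QSh.closeBlock, hφ.map_mul]
  have e3 : ∀ Z : B ⊗[K] B,
      Q (mul1324 K B B (TensorProduct.map D.δ.toLinearMap D.δ.toLinearMap Z)) =
      QSh.closeBlock K V (TensorProduct.map (QSh.block K V ∘ₗ φ)
        (TensorProduct.map φ φ ∘ₗ D.δ.toLinearMap) Z) := by
    intro Z
    induction Z with
    | zero => simp
    | add a b ha hb => simp only [map_add, ha, hb]
    | tmul a b =>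
      rw [TensorProduct.map_tmul, e2, TensorProduct.map_tmul, LinearMap.comp_apply (QSh.block K V),
        hφ.block_map hρ hδ]
      rfl
  refine DFunLike.congr_fun (hB.eq_of_eq_left
    (LinearMap.toSpanSingleton K (TensorAlgebra K V ⊗[K] TensorAlgebra K V) (1 ⊗ₜ 1) ∘ₗ
      Coalgebra.counit (R := K) (A := B))
    (QSh.closeBlock K V) (QSh.block K V ∘ₗ φ) (by simp [hφ.map_one, QSh.block_one])
    (Φ := QSh.delta K V ∘ₗ φ) (Ψ := TensorProduct.map φ φ ∘ₗ D.δ.toLinearMap)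
    (fun x => ?_) fun x => ?_) x
  · rw [LinearMap.comp_apply, QSh.delta_eq, hφ.map_counit, hφ.map_comul,
      ← LinearMap.comp_apply (TensorProduct.map _ _) (TensorProduct.map _ _),
      ← TensorProduct.map_comp]
    rfl
  · rw [← e3, LinearMap.comp_apply, AlgHom.toLinearMap_apply, e1,
      D.isBialgebraOver.counit_comodule, D.isBialgebraOver.comul_comodule]
    congr 1
    simp [Algebra.algebraMap_eq_smul_one, hφ.map_one]

/-- The product is respected because `δ` and `χ` are algebra maps, `Δ` and its counit because they
are comodule maps for `δ`, and `ρ` because it commutes with `δ`. -/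
theorem IsBialgebraOverHom.characterAct (hφ : IsBialgebraOverHom ρ φ)
    (hρ : IsDoubleBialgebraOver D ρ) (χ : B →ₐ[K] K) :
    IsBialgebraOverHom ρ (characterAct D φ χ) where
  map_one := by
    simp [characterAct_apply, Algebra.TensorProduct.one_def, hφ.map_one]
  map_mul x y := by
    rw [characterAct_apply, characterAct_apply, characterAct_apply, _root_.map_mul]
    generalize D.δ x = Z
    generalize D.δ y = Y
    induction Z with
    | zero => simp
    | add a b ha hb => simp only [add_mul, map_add, LinearMap.add_apply, ha, hb]
    | tmul a b =>
      induction Y with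
      | zero => simp
      | add c d hc hd => simp only [mul_add, map_add, hc, hd]
      | tmul c d => simp [hφ.map_mul, smul_smul, mul_comm]
  map_counit x := by
    have h : ∀ Z : B ⊗[K] B, QSh.counit K V (TensorProduct.rid K _
        (TensorProduct.map φ χ.toLinearMap Z)) =
        χ (TensorProduct.lid K B
          (LinearMap.rTensor B (Coalgebra.counit (R := K) (A := B)) Z)) := by
      intro Z
      induction Z with
      | zero => simp
      | add a b ha hb => simp only [map_add, ha, hb]
      | tmul a b => simp [hφ.map_counit, mul_comm]
    rw [characterAct_apply, h, D.isBialgebraOver.counit_comodule]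
    simp
  map_comul x := by
    have h1 : ∀ Z : B ⊗[K] B, QSh.comul K V (TensorProduct.rid K _
        (TensorProduct.map φ χ.toLinearMap Z)) =
        TensorProduct.rid K _ (TensorProduct.map (TensorProduct.map φ φ) χ.toLinearMap
          (LinearMap.rTensor B (Coalgebra.comul (R := K) (A := B)) Z)) := by
      intro Z
      induction Z with
      | zero => simp
      | add a b ha hb => simp only [map_add, ha, hb]
      | tmul a b => simp [hφ.map_comul]
    have h2 : ∀ Y X : B ⊗[K] B, TensorProduct.rid K _ (TensorProduct.map (TensorProduct.map φ φ)
        χ.toLinearMap (mul1324 K B B (Y ⊗ₜ X))) =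
        TensorProduct.rid K _ (TensorProduct.map φ χ.toLinearMap Y) ⊗ₜ
          TensorProduct.rid K _ (TensorProduct.map φ χ.toLinearMap X) := by
      intro Y X
      induction Y with
      | zero => simp
      | add a b ha hb => simp only [TensorProduct.add_tmul, map_add, ha, hb]
      | tmul a b =>
        induction X with
        | zero => simp
        | add c d hc hd => simp only [TensorProduct.tmul_add, map_add, hc, hd]
        | tmul c d =>
          simp [mul1324, TensorProduct.smul_tmul', smul_smul, mul_comm]
    have h3 : ∀ Z : B ⊗[K] B, TensorProduct.rid K _ (TensorProduct.map (TensorProduct.map φ φ)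
        χ.toLinearMap (mul1324 K B B (TensorProduct.map D.δ.toLinearMap D.δ.toLinearMap Z))) =
        TensorProduct.map (_root_.characterAct D φ χ) (_root_.characterAct D φ χ) Z := by
      intro Z
      induction Z with
      | zero => simp
      | add a b ha hb => simp only [map_add, ha, hb]
      | tmul a b => rw [TensorProduct.map_tmul, h2]; rfl
    rw [characterAct_apply, h1, D.isBialgebraOver.comul_comodule, h3]
  map_coaction x := by
    have h1 : ∀ Z : B ⊗[K] B, QSh.coaction K V (TensorProduct.rid K _
        (TensorProduct.map φ χ.toLinearMap Z)) =
        TensorProduct.rid K _ (TensorProduct.map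
          (LinearMap.rTensor (Unitization K V) φ ∘ₗ ρ.toLinearMap) χ.toLinearMap Z) := by
      intro Z
      induction Z with
      | zero => simp
      | add a b ha hb => simp only [map_add, ha, hb]
      | tmul a b => simp [hφ.map_coaction]
    rw [characterAct_apply, h1, ← LinearMap.map_comp_rTensor, LinearMap.comp_apply,
      TensorProduct.rid_map_rTensor_rightComm, hρ.compat, ← LinearMap.rTensor_comp_apply]
    rfl

end DoubleBialgebra

end Universal

end

/-! ### The main theorem -/

theorem mainTheorem3 {K V B : Type*} [Field K] [CharZero K]
    [NonUnitalCommRing V] [Module K V] [IsScalarTower K V V] [SMulCommClass K V V]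
    [Coalgebra K V] [NonunitalBialgebra K V] [Coalgebra.IsCocomm K V]
    [Ring B] [Bialgebra K B] (D : DoubleBialgebra K B) (ρ : B →ₐ[K] B ⊗[K] Unitization K V)
    (hρ : IsDoubleBialgebraOver D ρ) (hB : IsConnectedBialgebra K B) :
    ∃ φ₁ : B →ₗ[K] TensorAlgebra K V,
      IsDoubleBialgebraOverHom D ρ φ₁ ∧
      (∀ ψ : B →ₗ[K] TensorAlgebra K V, IsDoubleBialgebraOverHom D ρ ψ → ψ = φ₁) ∧
      ∃ θ : (B →ₐ[K] K) ≃ {φ : B →ₗ[K] TensorAlgebra K V // IsBialgebraOverHom ρ φ},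
        (∀ χ : B →ₐ[K] K, (θ χ).1 = characterAct D φ₁ χ) ∧
        (∀ φ : {φ : B →ₗ[K] TensorAlgebra K V // IsBialgebraOverHom ρ φ},
          ∀ x : B, θ.symm φ x = QSh.counitδ K V (φ.1 x)) := by
  -- A morphism of double bialgebras must satisfy `ε_δ ∘ φ = ε_δ`, which forces this choice of
  -- character.
  obtain ⟨φ₁, hφ₁, hδ⟩ := exists_isBialgebraOverHom hρ.toOver hB D.εδ
  refine ⟨φ₁, { hφ₁ with map_counitδ := hδ, map_delta := hφ₁.map_delta hρ hB hδ },
    fun ψ hψ => hψ.toIsBialgebraOverHom.eq_of_counitδ_eq hB hφ₁ hψ.map_counitδ hδ,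
    { toFun := fun χ => ⟨characterAct D φ₁ χ, hφ₁.characterAct hρ χ⟩
      invFun := fun φ => φ.2.character
      left_inv := fun χ => AlgHom.ext (counitδ_characterAct hδ χ)
      -- `φ₁ ⇜ (ε_δ ∘ φ)` and `φ` have the same composition with `ε_δ`, so they agree.
      right_inv := fun φ => Subtype.ext ((hφ₁.characterAct hρ φ.2.character).eq_of_counitδ_eq hB
        φ.2 (counitδ_characterAct hδ φ.2.character) fun _ => rfl) },
    fun _ => rfl, fun _ _ => rfl⟩
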